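/- **Setting.** A plant $\dot x_p=f_p(x_p,\hat u,w)$ and a controller $\dot x_c=f_c(x_c,\hat x_p)$, $u=g_c(x_c,x_p)$ are sampled at instants $t_j$ with zero-order hold. Let $x=(x_p,x_c)\in\mathbb R^{n_x}$, let $\hat x$ be the last sampled value of $x$, $e=\hat x-x$, and let $$f(x,e,w)=\begin{pmatrix} f_p(x_p,g_c(x_c+e_{x_c},x_p+e_{x_p}),w)\\ f_c(x_c,x_p+e_{x_p})\end{pmatrix},\qquad g=-f ,$$ where $f$ is continuous. For $\Gamma:\mathbb R^{n_x}\times\mathbb R\to(0,\infty)$ and $S:\mathbb R\times\mathbb R^{n_x}\to\mathbb R$, $\mathcal H_{STC}$ is the hybrid system with state $\xi=(x,e,\eta,\tau,\tau_{\max})$ that flows by $\dot x=f(x,e,w)$, $\dot e=g(x,e,w)$, $\dot\eta=0$, $\dot\tau=1$, $\dot\tau_{\max}=0$ where $\tau\le\tau_{\max}$, and jumps where $\tau=\tau_{\max}$ by $x^+=x$, $e^+=0$, $\eta^+=S(\eta,x)$, $\tau^+=0$, $\tau_{\max}^+=\Gamma(x,\eta)$. Initially $\tau(0,0)\ge0$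 and $\tau_{\max}(0,0)=\tau(0,0)$, so that the first jump is at $t_0=0$; the $(j+1)$-st jump is at $t_j$. The disturbance $w$ is locally integrable with $|w(t)|\le\bar w$ for all $t\ge0$, where $\bar w>0$. **Assumption.** Write $\mathcal X_c=\{x: V(x)\le c\}$. Let $V:\mathbb R^{n_x}\to\mathbb R_{\ge0}$ be locally Lipschitz with $\underline\alpha_V(|x|)\le V(x)\le\overline\alpha_V(|x|)$ for some $\underline\alpha_V,\overline\alpha_V\in\mathcal K_\infty$, and let $\alpha_w\in\mathcal K_\infty$. There are levels $c_l>0$, $l\in\{1,\dots,n_c\}$, and parameters $\epsilon_{i,l}\in\mathbb R$, $\gamma_{i,l},L_{i,l}>0$, $i\in\{1,\dots,n_{\rm par}\}$ ($n_c,n_{\rm par}\ge1$), with $\epsilon_{1,l}>0$ and $\epsilon_{i,l}<0$ for $i>1$, such that for each $(i,l)$, with $c=c_l$, $\epsilon=\epsilon_{i,l}$, $\gamma=\gamma_{i,l}$, $L=L_{i,l}$, there are a locally Lipschitz $W:\mathbb R^{n_x}\to\mathbb R_{\ge0}$ with $\underline\alpha_W(|e|)\le W(e)\le\overline\alpha_W(|e|)$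 for some $\underline\alpha_W,\overline\alpha_W\in\mathcal K_\infty$, and a function $H(x,e,w)\ge0$, defined and continuous for $x,e\in\mathbb R^{n_x}$ and $|w|\le\bar w$, such that - for all $x\in\mathcal X_c$, all $|w|\le\bar w$ and almost all $e$ with $x+e\in\mathcal X_c$: $\langle\nabla W(e),g(x,e,w)\rangle\le L\,W(e)+H(x,e,w)$; - for all $e$, all $|w|\le\bar w$ and almost all $x$ with $x\in\mathcal X_c$ and $x+e\in\mathcal X_c$: $\langle\nabla V(x),f(x,e,w)\rangle\le-\epsilon V(x)-H(x,e,w)^2+\gamma^2W(e)^2+\alpha_w(|w|)$. Moreover, no $c_l$ is the value of $V$ at a local minimum of $V$. **Mechanism.** For $r=\sqrt{|(\gamma/\Lambda)^2-1|}$ let $T_{\max}(\gamma,\Lambda)$ be $\frac{1}{\Lambda r}\arctan r$ if $\gamma>\Lambda$, $\frac1\Lambda$ if $\gamma=\Lambda$, and $\frac1{\Lambda r}\operatorname{arctanh} r$ if $\gamma<\Lambda$. Let $\delta\in(0,1)$, $\epsilon_{\rm ref}>0$, and let $$\max_l\frac{\alpha_w(\bar w)}{\epsilon_{1,l}}\le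 c_w\le c_{\max}\le\max_l c_l .$$ If the first inequality is an equality, suppose in addition that $f$ is Lipschitz in $(x,e)$ on bounded sets, uniformly in $|w|\le\bar w$. Put $$C(x,\eta)=c_w+\eta,\qquad S(\eta,x)=e^{-\epsilon_{\rm ref}\Gamma(x,\eta)}\eta,\qquad \eta(0,0)=\min\{\max\{V(x(0,0))-c_w,0\},\,c_{\max}-c_w\},$$ which implements the reference function $c_w+e^{-\epsilon_{\rm ref}t}\min\{\max\{V(x(0,0))-c_w,0\},c_{\max}-c_w\}$. The value $\Gamma(x,\eta)$ is computed from $V=V(x)$ and $C=C(x,\eta)$ as follows. Let $l$ be the smallest index with $c_l\ge\max\{V,C\}$. Then $\Gamma(x,\eta)$ is the maximum of $\delta T_{\max}(\gamma_{1,l},L_{1,l}+\frac{\epsilon_{1,l}}2)$ and of the numbers $\bar h_i$, $2\le i\le n_{\rm par}$, where, with $\Lambda_{i,l}=\max\{L_{i,l}+\frac{\epsilon_{i,l}}2,1-\delta\}$: $\bar h_i=0$ if $C<V$; and if $C\ge V$, then $$\bar h_i=\min\left\{\delta T_{\max}(\gamma_{i,l},\Lambda_{i,l}),\ \frac{\log\big(C-\frac{\alpha_w(\bar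 w)}{\epsilon_{i,l}}\big)-\log\big(V-\frac{\alpha_w(\bar w)}{\epsilon_{i,l}}\big)}{-\epsilon_{i,l}+\epsilon_{\rm ref}}\right\}$$ if $-\epsilon_{i,l}+\epsilon_{\rm ref}>0$, and $\bar h_i=\delta T_{\max}(\gamma_{i,l},\Lambda_{i,l})$ otherwise. If there is no such $l$, then $\Gamma(x,\eta)=t_{\min}$, with $t_{\min}$ as below. **Conclusion.** For every solution of $\mathcal H_{STC}$ with such a disturbance and such initial values, $$t_{j+1}-t_j\ \ge\ t_{\min}:=\min_{l}\ \delta\,T_{\max}\Big(\gamma_{1,l},L_{1,l}+\frac{\epsilon_{1,l}}2\Big)>0$$ for any two consecutive sampling instants. Moreover, $\{V\le c_w\}$ is robustly asymptotically stable with region of attraction $\mathcal X_{c_{\max}}$: there is $\beta\in\mathcal{KLL}$ such that for all such disturbances and all solutions with such initial values and $V(x(0,0))\le c_{\max}$ ($e(0,0)$ arbitrary), $$V(x(t,j))\le c_w+\beta\big(\max\{V(x(0,0))-c_w,0\}+|(e(0,0),\eta(0,0))|,\,t,\,j\big)$$ for all $(t,j)$ in the domain of the solution. -/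

import Mathlib

open Set Filter Topology MeasureTheory

noncomputable section

namespace DynSTC

/-! ### Comparison functions -/

/-- Class `𝒦`: continuous, strictly increasing on `[0, ∞)`, zero at zero. -/
structure IsClassK (α : ℝ → ℝ) : Prop where
  continuousOn : ContinuousOn α (Ici 0)
  strictMonoOn : StrictMonoOn α (Ici 0)
  map_zero : α 0 = 0

/-- Class `𝒦∞`: class `𝒦` and unbounded. -/
structure IsClassKInf (α : ℝ → ℝ) : Prop extends IsClassK α where
  tendsto_atTop : Tendsto α atTop atTop

/-- Class `𝒦ℒ`. -/
structure IsClassKL (β : ℝ → ℝ → ℝ) : Prop where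
  continuousOn : ContinuousOn (fun p : ℝ × ℝ => β p.1 p.2) (Ici 0 ×ˢ Ici 0)
  classK : ∀ t, 0 ≤ t → IsClassK (fun s => β s t)
  antitoneOn : ∀ s, 0 ≤ s → AntitoneOn (β s) (Ici 0)
  tendsto_zero : ∀ s, 0 ≤ s → Tendsto (β s) atTop (𝓝 0)

/-- Class `𝒦ℒℒ`: freezing either of the last two arguments gives a class `𝒦ℒ` function. -/
structure IsClassKLL (β : ℝ → ℝ → ℝ → ℝ) : Prop where
  left : ∀ r, 0 ≤ r → IsClassKL (fun s t => β s r t)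
  right : ∀ r, 0 ≤ r → IsClassKL (fun s t => β s t r)

/-! ### Hybrid systems -/

/-- Compact hybrid time domain `⋃_{j < J} [t_j, t_{j+1}] × {j}` with `0 = t_0 ≤ … ≤ t_J`. -/
def IsCompactHybridTimeDomain (E : Set (ℝ × ℕ)) : Prop :=
  ∃ (J : ℕ) (t : ℕ → ℝ), t 0 = 0 ∧ (∀ j < J, t j ≤ t (j + 1)) ∧
    E = {p | p.2 < J ∧ t p.2 ≤ p.1 ∧ p.1 ≤ t (p.2 + 1)}

/-- Hybrid time domain: every truncation at one of its points is a compact one. -/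
structure IsHybridTimeDomain (E : Set (ℝ × ℕ)) : Prop where
  nonneg : ∀ p ∈ E, 0 ≤ p.1
  compact : ∀ p ∈ E, IsCompactHybridTimeDomain (E ∩ {q | 0 ≤ q.1 ∧ q.1 ≤ p.1 ∧ q.2 ≤ p.2})

/-- Data `(F, G, C, D)` of a hybrid system with state in `Ξ` and input in `U`. -/
structure HybridSystem (Ξ U : Type*) where
  /-- flow map -/
  F : Ξ → U → Ξ
  /-- jump map -/
  G : Ξ → Ξ
  /-- flow set -/
  C : Set Ξ
  /-- jump set -/
  D : Set Ξ

/-- `ξ`, on the hybrid time domain `E`, solves the hybrid system for the input `w`. Values of `ξ`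
off `E` and of `w` at negative times are irrelevant. -/
structure HybridSystem.IsSolution {Ξ U : Type*} [NormedAddCommGroup Ξ] [NormedSpace ℝ Ξ]
    [NormedAddCommGroup U] (S : HybridSystem Ξ U) (w : ℝ → U)
    (E : Set (ℝ × ℕ)) (ξ : ℝ → ℕ → Ξ) : Prop where
  domain : IsHybridTimeDomain E
  input : LocallyIntegrableOn w (Ici 0)
  /-- absolute continuity in `t` on the compact subintervals of each `{t | (t, j) ∈ E}` -/
  absCont : ∀ (j : ℕ) (a b : ℝ), a ≤ b → (a, j) ∈ E → (b, j) ∈ E →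
    AbsolutelyContinuousOnInterval (fun t => ξ t j) a b
  flow : ∀ j : ℕ, ∀ᵐ t : ℝ, (t, j) ∈ E → ξ t j ∈ S.C ∧
    HasDerivWithinAt (fun s => ξ s j) (S.F (ξ t j) (w t)) {s | (s, j) ∈ E} t
  jump : ∀ (t : ℝ) (j : ℕ), (t, j) ∈ E → (t, j + 1) ∈ E →
    ξ t j ∈ S.D ∧ ξ t (j + 1) = S.G (ξ t j)

/-! ### The sampled-data closed loop -/

/-- `ℝ^n` with the Euclidean norm. -/
abbrev Vec (n : ℕ) := EuclideanSpace ℝ (Fin n)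

/-- `ℝ^{p+q}` with the Euclidean norm: stacked plant (`p`) and controller (`q`) coordinates. -/
abbrev XVec (p q : ℕ) := EuclideanSpace ℝ (Fin p ⊕ Fin q)

/-- Plant part of a stacked vector. -/
def plantPart {p q : ℕ} (x : XVec p q) : Vec p := WithLp.toLp 2 fun i => x (Sum.inl i)

/-- Controller part of a stacked vector. -/
def ctrlPart {p q : ℕ} (x : XVec p q) : Vec q := WithLp.toLp 2 fun i => x (Sum.inr i)

/-- Plant `ẋ_p = f_p(x_p, û, w)` and controller `ẋ_c = f_c(x_c, x̂_p)`, `u = g_c(x_c, x_p)`. -/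
structure Loop (p q nu nw : ℕ) where
  fp : Vec p → Vec nu → Vec nw → Vec p
  fc : Vec q → Vec p → Vec q
  gc : Vec q → Vec p → Vec nu

/-- Right-hand side `f(x, e, w)` of the combined state; `x + e` is the last sampled state. -/
def Loop.f {p q nu nw : ℕ} (P : Loop p q nu nw) (x e : XVec p q) (w : Vec nw) : XVec p q :=
  WithLp.toLp 2 (Sum.elim
    (fun i => P.fp (plantPart x)
      (P.gc (ctrlPart x + ctrlPart e) (plantPart x + plantPart e)) w i)
    (fun i => P.fc (ctrlPart x) (plantPart x + plantPart e) i))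

/-- Right-hand side of the sampling-induced error. -/
def Loop.g {p q nu nw : ℕ} (P : Loop p q nu nw) (x e : XVec p q) (w : Vec nw) : XVec p q :=
  -P.f x e w

/-- Hybrid state `ξ = (x, e, η, τ, τ_max)` for a scalar dynamic variable `η`. -/
abbrev HState (p q : ℕ) := XVec p q × XVec p q × ℝ × ℝ × ℝ

namespace HState

variable {p q : ℕ}

/-- Combined plant and controller state. -/
abbrev x (ξ : HState p q) : XVec p q := ξ.1
/-- Sampling-induced error. -/
abbrev e (ξ : HState p q) : XVec p q := ξ.2.1
/-- Dynamic variable of the sampling mechanism. -/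
abbrev η (ξ : HState p q) : ℝ := ξ.2.2.1
/-- Time since the last sampling instant. -/
abbrev τ (ξ : HState p q) : ℝ := ξ.2.2.2.1
/-- Current sampling interval. -/
abbrev τmax (ξ : HState p q) : ℝ := ξ.2.2.2.2

end HState

/-- The hybrid system `ℋ_STC` of the loop `P` with the sampling mechanism `(Γ, S)`. -/
def stcSystem {p q nu nw : ℕ} (P : Loop p q nu nw)
    (Γ : XVec p q → ℝ → ℝ) (S : ℝ → XVec p q → ℝ) : HybridSystem (HState p q) (Vec nw) where
  F ξ w := (P.f ξ.x ξ.e w, P.g ξ.x ξ.e w, 0, 1, 0)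
  G ξ := (ξ.x, 0, S ξ.η ξ.x, 0, Γ ξ.x ξ.η)
  C := {ξ | ξ.τ ≤ ξ.τmax}
  D := {ξ | ξ.τ = ξ.τmax}

/-- Sublevel set `𝒳_c` of `V`. -/
def sublevel {X : Type*} (V : X → ℝ) (c : ℝ) : Set X := {x | V x ≤ c}

/-- The disturbance signal takes its values in the closed ball of radius `wbar`. -/
def BoundedDisturbance {nw : ℕ} (wbar : ℝ) (w : ℝ → Vec nw) : Prop := ∀ t, 0 ≤ t → ‖w t‖ ≤ wbar

/-- Robust asymptotic stability of `{V ≤ cw}` with region of attraction `{V ≤ cmax}`, for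
disturbances bounded by `wbar` and solutions that start in the set `init` of admissible initial
hybrid states. The same `β` serves all disturbances and all solutions. -/
def IsRAS {p q nw : ℕ} (H : HybridSystem (HState p q) (Vec nw)) (wbar : ℝ)
    (V : XVec p q → ℝ) (cw cmax : ℝ) (init : Set (HState p q)) : Prop :=
  ∃ β : ℝ → ℝ → ℝ → ℝ, IsClassKLL β ∧
    ∀ (w : ℝ → Vec nw), BoundedDisturbance wbar w →
    ∀ (E : Set (ℝ × ℕ)) (ξ : ℝ → ℕ → HState p q), H.IsSolution w E ξ →
      ξ 0 0 ∈ init → (ξ 0 0).x ∈ sublevel V cmax →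
      ∀ (t : ℝ) (j : ℕ), (t, j) ∈ E →
        V (ξ t j).x ≤ cw +
          β (max (V (ξ 0 0).x - cw) 0 + √(‖(ξ 0 0).e‖ ^ 2 + (ξ 0 0).η ^ 2)) t j

/-! ### Local hybrid Lyapunov condition -/

/-- The local hybrid Lyapunov condition on `{V ≤ c}` with parameters `ε, γ, L`, for the given
functions `V` and `αw`. -/
structure LocalHybridLyapunov {p q nu nw : ℕ} (P : Loop p q nu nw) (wbar : ℝ)
    (V : XVec p q → ℝ) (αw : ℝ → ℝ) (c ε γ L : ℝ) : Prop where
  c_pos : 0 < c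
  L_pos : 0 < L
  γ_pos : 0 < γ
  αw_classKInf : IsClassKInf αw
  V_nonneg : ∀ x, 0 ≤ V x
  V_locallyLipschitz : LocallyLipschitz V
  V_bounds : ∃ αlo αhi : ℝ → ℝ, IsClassKInf αlo ∧ IsClassKInf αhi ∧
    ∀ x, αlo ‖x‖ ≤ V x ∧ V x ≤ αhi ‖x‖
  exists_W_H : ∃ (W : XVec p q → ℝ) (H : XVec p q → XVec p q → Vec nw → ℝ),
    (∀ e, 0 ≤ W e) ∧ LocallyLipschitz W ∧
    (∃ αlo αhi : ℝ → ℝ, IsClassKInf αlo ∧ IsClassKInf αhi ∧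
      ∀ e, αlo ‖e‖ ≤ W e ∧ W e ≤ αhi ‖e‖) ∧
    (∀ x e w, ‖w‖ ≤ wbar → 0 ≤ H x e w) ∧
    ContinuousOn (fun z : XVec p q × XVec p q × Vec nw => H z.1 z.2.1 z.2.2)
      {z | ‖z.2.2‖ ≤ wbar} ∧
    (∀ x ∈ sublevel V c, ∀ w : Vec nw, ‖w‖ ≤ wbar →
      ∀ᵐ e : XVec p q, x + e ∈ sublevel V c →
        inner ℝ (gradient W e) (P.g x e w) ≤ L * W e + H x e w) ∧
    (∀ e : XVec p q, ∀ w : Vec nw, ‖w‖ ≤ wbar →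
      ∀ᵐ x : XVec p q, x ∈ sublevel V c → x + e ∈ sublevel V c →
        inner ℝ (gradient V x) (P.f x e w) ≤
          -ε * V x - H x e w ^ 2 + γ ^ 2 * W e ^ 2 + αw ‖w‖)

/-! ### The sampling mechanism -/

/-- `T_max(γ, Λ)`. -/
def Tmax (γ Λ : ℝ) : ℝ :=
  let r := √|(γ / Λ) ^ 2 - 1|
  if Λ < γ then 1 / (Λ * r) * Real.arctan r
  else if γ = Λ then 1 / Λ
  else 1 / (Λ * r) * Real.artanh r

/-- Levels `c_l`, parameters `ε_{i,l}, γ_{i,l}, L_{i,l}`, and the tuning constants. The index `0`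
of the parameter sets is the one of the fall-back strategy. -/
structure Params (npar nc : ℕ) where
  c : Fin nc → ℝ
  ε : Fin npar → Fin nc → ℝ
  γ : Fin npar → Fin nc → ℝ
  L : Fin npar → Fin nc → ℝ
  εref : ℝ
  δ : ℝ

namespace Params

variable {npar nc : ℕ} [NeZero npar] [NeZero nc] (A : Params npar nc)

/-- Sampling interval of the fall-back strategy for the level `l`. -/
def fallback (l : Fin nc) : ℝ := A.δ * Tmax (A.γ 0 l) (A.L 0 l + A.ε 0 l / 2)

/-- Smallest fall-back sampling interval. -/
def tMin : ℝ := Finset.univ.inf' Finset.univ_nonempty fun l => A.fallback l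

/-- Candidate sampling interval of parameter set `i` at level `l`, for the values `v` of `V(x)`
and `C` of `C(x, η)`; `aw` stands for `α_w(w̄)`. -/
def candidate (aw v C : ℝ) (l : Fin nc) (i : Fin npar) : ℝ :=
  let T := A.δ * Tmax (A.γ i l) (max (A.L i l + A.ε i l / 2) (1 - A.δ))
  if v ≤ C then
    if 0 < -A.ε i l + A.εref then
      min T ((Real.log (C - aw / A.ε i l) - Real.log (v - aw / A.ε i l)) /
        (-A.ε i l + A.εref))
    else T
  else 0

/-- Output of the algorithm at level `l`: the loop over `i` starts from the fall-back interval and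
keeps the largest value met. -/
def interval (aw v C : ℝ) (l : Fin nc) : ℝ :=
  Finset.univ.sup' Finset.univ_nonempty fun i : Fin npar =>
    if i = 0 then A.fallback l else A.candidate aw v C l i

open Classical in
/-- The levels that are at least `max {v, C}`. -/
def levels (v C : ℝ) : Finset (Fin nc) := Finset.univ.filter fun l => max v C ≤ A.c l

open Classical in
/-- The sampling interval as a function of the values `v` of `V(x)` and `C` of `C(x, η)`: the
output of the algorithm at the first level `l` with `c_l ≥ max {v, C}`. If there is no such level,
the algorithm is undefined, and the value `tMin` is used. -/
def algorithm (aw v C : ℝ) : ℝ :=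
  if h : (A.levels v C).Nonempty then A.interval aw v C ((A.levels v C).min' h) else A.tMin

/-- `Γ(x, η)` for the choice `C(x, η) = c_w + η`. -/
def refΓ {X : Type*} (V : X → ℝ) (aw cw : ℝ) (x : X) (η : ℝ) : ℝ :=
  A.algorithm aw (V x) (cw + η)

/-- `S(η, x) = e^{-ε_ref Γ(x, η)} η`. -/
def refS {X : Type*} (V : X → ℝ) (aw cw : ℝ) (η : ℝ) (x : X) : ℝ :=
  Real.exp (-A.εref * A.refΓ V aw cw x η) * η

end Params

/-- Initial value of the dynamic variable. -/
def refη {X : Type*} (V : X → ℝ) (cw cmax : ℝ) (x : X) : ℝ := min (max (V x - cw) 0) (cmax - cw)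

/-- Admissible initial hybrid states: `τ(0,0) ≥ 0`, `τ_max(0,0) = τ(0,0)`, and the prescribed
initial value of the dynamic variable. -/
def refInit {p q : ℕ} (V : XVec p q → ℝ) (cw cmax : ℝ) : Set (HState p q) :=
  {ξ | 0 ≤ ξ.τ ∧ ξ.τmax = ξ.τ ∧ ξ.η = refη V cw cmax ξ.x}

/-- `f(x, e, w)` is Lipschitz in `(x, e)` on bounded sets, uniformly in `|w| ≤ wbar`. -/
def Loop.IsLipschitzOnBounded {p q nu nw : ℕ} (P : Loop p q nu nw) (wbar : ℝ) : Prop :=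
  ∀ R : ℝ, ∃ K : ℝ, ∀ x x' e e' : XVec p q, ‖x‖ ≤ R → ‖x'‖ ≤ R → ‖e‖ ≤ R → ‖e'‖ ≤ R →
    ∀ w : Vec nw, ‖w‖ ≤ wbar → ‖P.f x e w - P.f x' e' w‖ ≤ K * (‖x - x'‖ + ‖e - e'‖)

end DynSTC

end

open Set Filter Topology MeasureTheory

noncomputable section

namespace DynSTC

/-! ### Absolutely continuous functions -/

/-! Between two jumps the sampled state `x + e` is constant, so the error is `e t = x a - x t`. The
Lyapunov function is `U = V + χ W²`, where `χ > 0` solves the Riccati equation `χ' = -2Λχ - χ² - γ²`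
and `L + ε/2 ≤ Λ`. Completing the square in `H` gives `U' ≤ -ε U + α_w`. Since `e = 0` at a sampling
instant and `W 0 = 0`, `V` stays below the solution of the scalar linear equation that starts at its
sampled value. `Tmax` is the time in which a Riccati solution falls from infinity to zero, so `χ`
exists on intervals of length `δ Tmax`.

There are two obstacles. First, the gradient inequalities hold only almost everywhere, and a
trajectory may run inside the exceptional null set. By Fubini almost every parallel segment avoids
this set up to measure zero, and continuity does the rest (`sub_le_of_ae_inner_gradient_le`).
Second, on the boundary `V = c` the inequalities need not hold on a neighbourhood. Since `c` is not
a local minimum value, approximate arcs can start nearby with `V < c`. If `α_w / ε < c`, translates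
of the arc will do, because the gap absorbs their defect. In the limit case the defect must be small
relative to the gap `c - V` at the start, and Picard iteration for Lipschitz `f` provides such arcs.

With the fall-back interval, `V - c_w` decays at rate `ε_{1,l}`. With another interval, the
logarithm in the mechanism keeps the linear bound below `exp (-ε_ref s) C`. In both cases `max (V -
c_w, 0, η)` at the sampling instant bounds the later `V - c_w` with a factor `exp (-κ s)`
(`IsFlowArc.decay`). Induction over the jumps (`stc_decay`) gives decay in `t`, and the dwell time
`tMin` converts half of it into decay in `j`. -/

theorem lipschitzOnWith_comp_absolutelyContinuous {X Y : Type*} [PseudoMetricSpace X] [PseudoMetricSpace Y]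
    {g : X → Y} {K : NNReal} {s : Set X} {f : ℝ → X} {a b : ℝ} (hg : LipschitzOnWith K g s)
    (hf : AbsolutelyContinuousOnInterval f a b) (hs : MapsTo f (uIcc a b) s) :
    AbsolutelyContinuousOnInterval (fun t => g (f t)) a b := by
  rw [absolutelyContinuousOnInterval_iff] at hf ⊢
  intro ε hε
  obtain ⟨δ, hδ, h⟩ := hf (ε / (K + 1)) (by positivity)
  refine ⟨δ, hδ, fun E hE hEδ => ?_⟩
  have h1 := h E hE hEδ
  calc ∑ i ∈ Finset.range E.1, dist (g (f (E.2 i).1)) (g (f (E.2 i).2))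
      ≤ ∑ i ∈ Finset.range E.1, K * dist (f (E.2 i).1) (f (E.2 i).2) := by
        refine Finset.sum_le_sum fun i hi => ?_
        have hm := hE.1 i hi
        exact hg.dist_le_mul _ (hs hm.1) _ (hs hm.2)
    _ = K * ∑ i ∈ Finset.range E.1, dist (f (E.2 i).1) (f (E.2 i).2) := by
        rw [Finset.mul_sum]
    _ ≤ K * (ε / (K + 1)) := by gcongr
    _ < (K + 1) * (ε / (K + 1)) := by
        have : (0:ℝ) < ε / (K + 1) := by positivity
        nlinarith
    _ = ε := by field_simp

/-- The bound is asked only of derivatives that exist: absolute continuity supplies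
differentiability almost everywhere, and integrating the derivative recovers the increment. -/
theorem sub_le_of_absolutelyContinuous_of_ae_deriv_le {h : ℝ → ℝ} {a b M : ℝ} (hab : a ≤ b)
    (hh : AbsolutelyContinuousOnInterval h a b)
    (hd : ∀ᵐ t, t ∈ Ioo a b → ∀ v, HasDerivAt h v t → v ≤ M) :
    h b - h a ≤ M * (b - a) := by
  rw [← hh.integral_deriv_eq_sub]
  have h1 : ∫ t in a..b, deriv h t ≤ ∫ _ in a..b, M := by
    rw [intervalIntegral.integral_of_le hab, intervalIntegral.integral_of_le hab]
    have hi := hh.intervalIntegrable_deriv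
    rw [intervalIntegrable_iff_integrableOn_Ioc_of_le hab] at hi
    refine setIntegral_mono_ae_restrict hi (by simp) ?_
    rw [EventuallyLE, ae_restrict_iff' measurableSet_Ioc]
    filter_upwards [hd, hh.ae_differentiableAt, Measure.ae_ne volume b] with t ht hdt hne hmem
    exact ht ⟨hmem.1, lt_of_le_of_ne hmem.2 hne⟩ _
      (hdt (by rw [uIcc_of_le hab]; exact Ioc_subset_Icc_self hmem)).hasDerivAt
  simpa [mul_comm] using h1

theorem exists_lipschitzOnWith_closedBall {E : Type*} [NormedAddCommGroup E] [ProperSpace E]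
    {F : E → ℝ} (hF : LocallyLipschitz F) (R : ℝ) :
    ∃ K : NNReal, LipschitzOnWith K F (Metric.closedBall 0 R) :=
  (hF.locallyLipschitzOn).exists_lipschitzOnWith_of_compact (isCompact_closedBall 0 R)

/-! ### Nonsmooth directional derivatives -/

section Directional

variable {E : Type*} [NormedAddCommGroup E] [InnerProductSpace ℝ E] [FiniteDimensional ℝ E]
  [MeasurableSpace E] [BorelSpace E]

/-- The segment from `y` may lie entirely in the exceptional null set, but almost every parallel
segment meets it in measure zero. The derivative bound is integrated along those and passed to the
limit. -/
theorem sub_le_of_ae_inner_gradient_le {F : E → ℝ} {K : NNReal} {z v : E} {r M : ℝ}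
    (hF : LipschitzOnWith K F (Metric.ball z r))
    (hM : ∀ᵐ y : E, y ∈ Metric.ball z r → inner ℝ (gradient F y) v ≤ M)
    {y : E} {h : ℝ} (hh : 0 ≤ h) (hy : y ∈ Metric.ball z r)
    (hyv : y + h • v ∈ Metric.ball z r) :
    F (y + h • v) - F y ≤ M * h := by
  have hgood : ∀ᵐ y : E, y ∈ Metric.ball z r →
      DifferentiableAt ℝ F y ∧ inner ℝ (gradient F y) v ≤ M := by
    filter_upwards [hM, hF.ae_differentiableWithinAt_of_mem (μ := volume)] with y h1 h2 hy
    exact ⟨(h2 hy).differentiableAt (Metric.isOpen_ball.mem_nhds hy), h1 hy⟩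
  obtain ⟨s, hs_sub, hs_meas, hs_ae⟩ : ∃ s : Set E, s ⊆ {y | y ∈ Metric.ball z r →
      DifferentiableAt ℝ F y ∧ inner ℝ (gradient F y) v ≤ M} ∧ MeasurableSet s ∧
      ∀ᵐ y : E, y ∈ s := by
    obtain ⟨t, ht1, ht2, ht3⟩ := exists_measurable_superset_of_null (ae_iff.1 hgood)
    refine ⟨tᶜ, ?_, ht2.compl, ?_⟩
    · intro y hy
      by_contra hcon
      exact hy (ht1 hcon)
    · rw [ae_iff]; simpa using ht3
  -- Fubini along the direction `v`; this is why a measurable set `s` of good points was extracted.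
  have hline : ∀ᵐ y : E, ∀ᵐ t : ℝ, y + t • v ∈ s := by
    have := (ae_ae_add_linearMap_mem_iff (LinearMap.toSpanSingleton ℝ E v) (volume : Measure ℝ)
      (volume : Measure E) hs_meas).2 hs_ae
    simpa using this
  have hball : ∀ y' ∈ Metric.ball z r, y' + h • v ∈ Metric.ball z r →
      ∀ t ∈ Icc 0 h, y' + t • v ∈ Metric.ball z r := by
    intro y' h1 h2 t ht
    rcases hh.eq_or_lt with h0 | h0
    · have : t = 0 := le_antisymm (h0 ▸ ht.2) ht.1
      simpa [this] using h1
    have := (convex_ball z r) h1 h2 (a := 1 - t / h) (b := t / h)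
      (by rw [sub_nonneg, div_le_one h0]; exact ht.2) (div_nonneg ht.1 hh) (by ring)
    convert! this using 1
    rw [smul_add, smul_smul, ← add_assoc, ← add_smul]
    rw [div_mul_cancel₀ _ h0.ne', sub_add_cancel, one_smul]
  have hkey : ∀ y', (∀ᵐ t : ℝ, y' + t • v ∈ s) → y' ∈ Metric.ball z r →
      y' + h • v ∈ Metric.ball z r → F (y' + h • v) - F y' - M * h ≤ 0 := by
    intro y' hae h1 h2
    have hb := hball y' h1 h2
    have hac : AbsolutelyContinuousOnInterval (fun t : ℝ => F (y' + t • v)) 0 h := by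
      refine lipschitzOnWith_comp_absolutelyContinuous (f := fun t : ℝ => y' + t • v) hF ?_ ?_
      · refine LipschitzOnWith.absolutelyContinuousOnInterval (K := ‖v‖₊) ?_
        refine LipschitzOnWith.of_dist_le_mul fun t _ t' _ => ?_
        rw [dist_add_left, dist_eq_norm, ← sub_smul, norm_smul, mul_comm, Real.dist_eq]
        simp
      · rw [uIcc_of_le hh]; exact hb
    have := sub_le_of_absolutelyContinuous_of_ae_deriv_le (M := M) hh hac (by
      filter_upwards [hae] with t ht htm w hw
      obtain ⟨hd, hi⟩ := hs_sub ht (hb t (Ioo_subset_Icc_self htm))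
      have h3 : HasDerivAt (fun t : ℝ => y' + t • v) v t := by
        simpa using ((hasDerivAt_id t).smul_const v).const_add y'
      have h4 := hd.hasFDerivAt.comp_hasDerivAt t h3
      rw [hw.unique h4, ← inner_gradient_left]
      exact hi)
    simp only [zero_smul, add_zero, sub_zero] at this
    linarith
  have hcont : Continuous fun y' : E => y' + h • v := by fun_prop
  have htend : Tendsto (fun y' => F (y' + h • v) - F y' - M * h) (𝓝 y)
      (𝓝 (F (y + h • v) - F y - M * h)) := by
    have c1 : ContinuousAt F y := hF.continuousOn.continuousAt (Metric.isOpen_ball.mem_nhds hy)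
    have c2 : ContinuousAt F (y + h • v) :=
      hF.continuousOn.continuousAt (Metric.isOpen_ball.mem_nhds hyv)
    exact ((ContinuousAt.comp (f := fun y' : E => y' + h • v) c2 hcont.continuousAt).sub c1).sub
      continuousAt_const
  -- A set of full measure is dense, so good base points accumulate at `y`.
  have hfreq : ∃ᶠ y' in 𝓝 y, F (y' + h • v) - F y' - M * h ≤ 0 := by
    have hd : Dense {y' : E | ∀ᵐ t : ℝ, y' + t • v ∈ s} := Measure.dense_of_ae hline
    have h1 : ∃ᶠ y' in 𝓝 y, ∀ᵐ t : ℝ, y' + t • v ∈ s :=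
      mem_closure_iff_frequently.1 (hd y)
    have h2 : ∀ᶠ y' in 𝓝 y, y' ∈ Metric.ball z r ∧ y' + h • v ∈ Metric.ball z r :=
      Filter.Eventually.and (Metric.isOpen_ball.mem_nhds hy)
        (hcont.continuousAt.eventually (Metric.isOpen_ball.mem_nhds hyv))
    exact (h1.and_eventually h2).mono fun y' hy' => hkey y' hy'.1 hy'.2.1 hy'.2.2
  have := le_of_tendsto_of_frequently htend hfreq
  linarith

/-- Upper bound for the derivative of a Lipschitz function along a curve whose velocity is close to
a direction in which the a.e. gradient is controlled. -/
theorem deriv_comp_le_of_ae_inner_gradient_le {F : E → ℝ} {K : NNReal} {y : ℝ → E} {v v' : E}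
    {t r d M : ℝ} (hr : 0 < r) (hF : LipschitzOnWith K F (Metric.ball (y t) r))
    (hM : ∀ η > 0, ∃ ρ > 0, ∀ᵐ z : E, z ∈ Metric.ball (y t) ρ → inner ℝ (gradient F z) v ≤ M + η)
    (hy : HasDerivAt y v' t) (hd : HasDerivAt (fun s => F (y s)) d t) :
    d ≤ M + K * ‖v' - v‖ := by
  refine le_of_forall_pos_le_add fun η hη => ?_
  obtain ⟨ρ₀, hρ₀, hρM⟩ := hM η hη
  set ρ := min ρ₀ r
  have hρ : 0 < ρ := lt_min hρ₀ hr
  have hFρ : LipschitzOnWith K F (Metric.ball (y t) ρ) :=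
    hF.mono (Metric.ball_subset_ball (min_le_right _ _))
  have hρM' : ∀ᵐ z : E, z ∈ Metric.ball (y t) ρ → inner ℝ (gradient F z) v ≤ M + η := by
    filter_upwards [hρM] with z hz hmem
    exact hz (Metric.ball_subset_ball (min_le_left _ _) hmem)
  have hs := hd.tendsto_slope_zero_right
  have hb : Tendsto (fun h : ℝ => (M + η) + K * ‖h⁻¹ • (y (t + h) - y t) - v‖) (𝓝[>] 0)
      (𝓝 ((M + η) + K * ‖v' - v‖)) :=
    ((hy.tendsto_slope_zero_right.sub_const v).norm.const_mul _).const_add _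
  have hle : ∀ᶠ h : ℝ in 𝓝[>] 0, h⁻¹ • (F (y (t + h)) - F (y t)) ≤
      (M + η) + K * ‖h⁻¹ • (y (t + h) - y t) - v‖ := by
    have e1 : ∀ᶠ h : ℝ in 𝓝[>] 0, y (t + h) ∈ Metric.ball (y t) ρ := by
      have hc : ContinuousAt (fun h : ℝ => y (t + h)) 0 := by
        refine ContinuousAt.comp (g := y) ?_ (by fun_prop)
        simpa using hy.continuousAt
      have : Tendsto (fun h : ℝ => y (t + h)) (𝓝[>] 0) (𝓝 (y t)) := by
        have := hc.tendsto.mono_left (nhdsWithin_le_nhds (s := Ioi 0))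
        simpa using this
      exact this.eventually (Metric.ball_mem_nhds _ hρ)
    have e2 : ∀ᶠ h : ℝ in 𝓝[>] 0, y t + h • v ∈ Metric.ball (y t) ρ := by
      have hc : Continuous (fun h : ℝ => y t + h • v) := by fun_prop
      have := hc.continuousAt.tendsto.mono_left (nhdsWithin_le_nhds (a := 0) (s := Ioi 0))
      simp only [zero_smul, add_zero] at this
      exact this.eventually (Metric.ball_mem_nhds _ hρ)
    filter_upwards [e1, e2, self_mem_nhdsWithin] with h h1 h2 h0
    have h0 : 0 < h := h0
    have k1 := sub_le_of_ae_inner_gradient_le hFρ hρM' h0.le (Metric.mem_ball_self hρ) h2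
    -- The curve is compared with the straight segment in direction `v`; the Lipschitz constant pays
    -- for the difference, which is `o(h)` up to `h ‖v' - v‖`.
    have k2 := (le_abs_self _).trans (hFρ.dist_le_mul _ h1 _ h2)
    rw [dist_eq_norm] at k2
    have k3 : ‖y (t + h) - (y t + h • v)‖ = h * ‖h⁻¹ • (y (t + h) - y t) - v‖ := by
      rw [← abs_of_pos h0, ← Real.norm_eq_abs, ← norm_smul, smul_sub, smul_smul,
        Real.norm_of_nonneg h0.le, mul_inv_cancel₀ h0.ne', one_smul, sub_sub]
    rw [k3] at k2
    rw [smul_eq_mul, inv_mul_le_iff₀ h0]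
    linarith
  have := le_of_tendsto_of_tendsto hs hb hle
  linarith

end Directional

/-! ### The Riccati equation behind `T_max` -/

theorem riccati_shift {ψ : ℝ → ℝ} {γ Λ t : ℝ}
    (h : HasDerivAt ψ (-ψ t ^ 2 + Λ ^ 2 - γ ^ 2) t) :
    HasDerivAt (fun s => ψ s - Λ) (-2 * Λ * (ψ t - Λ) - (ψ t - Λ) ^ 2 - γ ^ 2) t := by
  convert! h.sub_const Λ using 1
  ring

/-- With `ω = Λ r`, explicit solutions that blow up at `0` are `ω cot (ω t)`, `1 / t` and `ω coth (ω
t)` for `Λ < γ`, `Λ = γ` and `γ < Λ`. Each decreases and takes the value `Λ` exactly at `Tmax γ Λ`.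
-/
theorem Tmax_pos_and_exists_riccati {γ Λ : ℝ} (hγ : 0 < γ) (hΛ : 0 < Λ) :
    0 < Tmax γ Λ ∧ ∃ ψ : ℝ → ℝ, ∀ t ∈ Ioo 0 (Tmax γ Λ),
      Λ < ψ t ∧ HasDerivAt ψ (-ψ t ^ 2 + Λ ^ 2 - γ ^ 2) t := by
  rcases lt_trichotomy Λ γ with hlt | heq | hgt
  · have h1 : 1 < γ / Λ := (one_lt_div hΛ).2 hlt
    have h2 : 0 < (γ / Λ) ^ 2 - 1 := by nlinarith
    set r := √((γ / Λ) ^ 2 - 1) with hr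
    have hr0 : 0 < r := Real.sqrt_pos.2 h2
    have hr2 : r ^ 2 = (γ / Λ) ^ 2 - 1 := Real.sq_sqrt h2.le
    have hT : Tmax γ Λ = 1 / (Λ * r) * Real.arctan r := by
      simp only [Tmax, if_pos hlt, abs_of_pos h2, ← hr]
    set ω := Λ * r with hω
    have hω0 : 0 < ω := mul_pos hΛ hr0
    have hω2 : ω ^ 2 = γ ^ 2 - Λ ^ 2 := by
      rw [hω, mul_pow, hr2]; field_simp
    have hat : 0 < Real.arctan r := by simpa using Real.arctan_strictMono hr0
    rw [hT]
    refine ⟨by positivity, fun t => ω * Real.cos (ω * t) / Real.sin (ω * t), fun t ht => ?_⟩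
    have ht1 : 0 < ω * t := mul_pos hω0 ht.1
    have ht2 : ω * t < Real.arctan r := by
      have := ht.2
      rw [one_div, inv_mul_eq_div, lt_div_iff₀ hω0] at this
      linarith
    have ht3 := ht2.trans (Real.arctan_lt_pi_div_two r)
    have hsin : 0 < Real.sin (ω * t) := Real.sin_pos_of_pos_of_lt_pi ht1 (by linarith [Real.pi_pos])
    have hcos : 0 < Real.cos (ω * t) := Real.cos_pos_of_mem_Ioo ⟨by linarith [Real.pi_pos], ht3⟩
    constructor
    · have h3 : Real.tan (ω * t) < r := by
        have := Real.tan_lt_tan_of_lt_of_lt_pi_div_two (by linarith [Real.pi_pos])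
          (Real.arctan_lt_pi_div_two r) ht2
        rwa [Real.tan_arctan] at this
      rw [Real.tan_eq_sin_div_cos, div_lt_iff₀ hcos] at h3
      rw [lt_div_iff₀ hsin]
      nlinarith
    · have hl : HasDerivAt (fun t : ℝ => ω * t) ω t := by
        simpa using (hasDerivAt_id t).const_mul ω
      have h3 := ((hl.cos.const_mul ω).div hl.sin hsin.ne')
      convert! h3 using 1
      have h4 := Real.sin_sq_add_cos_sq (ω * t)
      rw [show -(ω * Real.cos (ω * t) / Real.sin (ω * t)) ^ 2 + Λ ^ 2 - γ ^ 2
        = -(ω * Real.cos (ω * t) / Real.sin (ω * t)) ^ 2 - ω ^ 2 by rw [hω2]; ring]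
      field_simp
      ring
  · subst heq
    have hT : Tmax Λ Λ = 1 / Λ := by simp [Tmax]
    rw [hT]
    refine ⟨by positivity, fun t => t⁻¹, fun t ht => ⟨?_, ?_⟩⟩
    · have := ht.2
      rw [lt_div_iff₀ hΛ] at this
      change Λ < t⁻¹
      rw [← one_div, lt_div_iff₀ ht.1]
      linarith
    · convert! hasDerivAt_inv ht.1.ne' using 1
      simp
  · have h1 : γ / Λ < 1 := (div_lt_one hΛ).2 hgt
    have h0 : 0 < γ / Λ := by positivity
    have h2 : 0 < 1 - (γ / Λ) ^ 2 := by nlinarith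
    set r := √(1 - (γ / Λ) ^ 2) with hr
    have hr0 : 0 < r := Real.sqrt_pos.2 h2
    have hr2 : r ^ 2 = 1 - (γ / Λ) ^ 2 := Real.sq_sqrt h2.le
    have hr1 : r < 1 := by nlinarith [pow_pos h0 2]
    have hT : Tmax γ Λ = 1 / (Λ * r) * Real.artanh r := by
      have : |(γ / Λ) ^ 2 - 1| = 1 - (γ / Λ) ^ 2 := by
        rw [abs_of_neg (by linarith)]; ring
      simp only [Tmax, if_neg hgt.not_gt, if_neg hgt.ne, this, ← hr]
    set ω := Λ * r with hω
    have hω0 : 0 < ω := mul_pos hΛ hr0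
    have hω2 : ω ^ 2 = Λ ^ 2 - γ ^ 2 := by
      rw [hω, mul_pow, hr2]; field_simp
    have hat : 0 < Real.artanh r := Real.artanh_pos ⟨hr0, hr1⟩
    rw [hT]
    refine ⟨by positivity, fun t => ω * Real.cosh (ω * t) / Real.sinh (ω * t), fun t ht => ?_⟩
    have ht1 : 0 < ω * t := mul_pos hω0 ht.1
    have ht2 : ω * t < Real.artanh r := by
      have := ht.2
      rw [one_div, inv_mul_eq_div, lt_div_iff₀ hω0] at this
      linarith
    have hsin : 0 < Real.sinh (ω * t) := Real.sinh_pos_iff.2 ht1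
    have hcos : 0 < Real.cosh (ω * t) := Real.cosh_pos _
    constructor
    · have hmem : Real.tanh (ω * t) ∈ Ioo (-1 : ℝ) 1 :=
        ⟨Real.neg_one_lt_tanh _, Real.tanh_lt_one _⟩
      have h3 : Real.tanh (ω * t) < r := by
        rw [← Real.artanh_lt_artanh_iff hmem ⟨by linarith, hr1⟩, Real.artanh_tanh]
        exact ht2
      rw [Real.tanh_eq_sinh_div_cosh, div_lt_iff₀ hcos] at h3
      rw [lt_div_iff₀ hsin]
      nlinarith
    · have hl : HasDerivAt (fun t : ℝ => ω * t) ω t := by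
        simpa using (hasDerivAt_id t).const_mul ω
      have h3 := ((hl.cosh.const_mul ω).div hl.sinh hsin.ne')
      convert! h3 using 1
      have h4 := Real.cosh_sq (ω * t)
      rw [show -(ω * Real.cosh (ω * t) / Real.sinh (ω * t)) ^ 2 + Λ ^ 2 - γ ^ 2
        = -(ω * Real.cosh (ω * t) / Real.sinh (ω * t)) ^ 2 + ω ^ 2 by rw [hω2]; ring]
      field_simp
      ring

theorem exists_riccati_on_Icc {γ Λ δ : ℝ} (hγ : 0 < γ) (hΛ : 0 < Λ) (hδ : δ ∈ Ioo (0 : ℝ) 1)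
    {a b : ℝ} (hab : b - a ≤ δ * Tmax γ Λ) :
    ∃ χ : ℝ → ℝ, ∀ t ∈ Icc a b, 0 < χ t ∧
      HasDerivAt χ (-2 * Λ * χ t - χ t ^ 2 - γ ^ 2) t := by
  obtain ⟨hT, ψ, hψ⟩ := Tmax_pos_and_exists_riccati hγ hΛ
  set T := Tmax γ Λ
  -- Half of the slack left by `δ < 1` separates the interval from the blow-up at `0`, the other
  -- half from the zero of `ψ - Λ` at `T`.
  set s := (1 - δ) * T / 2
  have hs : 0 < s := by have := sub_pos.2 hδ.2; positivity
  refine ⟨fun t => ψ (t - a + s) - Λ, fun t ht => ?_⟩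
  obtain ⟨h1, h2⟩ := hψ (t - a + s) ⟨by linarith [ht.1], by
    have : t - a ≤ δ * T := by linarith [ht.2]
    have : s + s = T - δ * T := by simp only [s]; ring
    linarith⟩
  refine ⟨sub_pos.2 h1, ?_⟩
  have h3 : HasDerivAt (fun t : ℝ => t - a + s) 1 t := ((hasDerivAt_id t).sub_const a).add_const s
  have h4 := (riccati_shift h2).comp t h3
  simpa [Function.comp_def] using h4

section

/-! ### The Lyapunov estimate between two sampling instants -/

section Directional

variable {E : Type*} [NormedAddCommGroup E] [InnerProductSpace ℝ E] [FiniteDimensional ℝ E]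

theorem norm_gradient_le_of_lipschitzOn {F : E → ℝ} {K : NNReal} {s : Set E} {z : E}
    (hs : s ∈ 𝓝 z) (hF : LipschitzOnWith K F s) : ‖gradient F z‖ ≤ K := by
  rw [gradient, LinearIsometryEquiv.norm_map]
  exact norm_fderiv_le_of_lipschitzOn ℝ hs hF

variable [MeasurableSpace E] [BorelSpace E]

/-- A gradient inequality along a continuous field gives an upper bound for the derivative along
curves whose velocity is close to the field. -/
theorem deriv_comp_le_of_field {F : E → ℝ} {K : NNReal} {D : E → E} {m : E → ℝ} {U : Set E}
    {y : ℝ → E} {v' : E} {t d r : ℝ} (hr : 0 < r)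
    (hF : LipschitzOnWith K F (Metric.ball (y t) r)) (hD : ContinuousAt D (y t))
    (hm : ContinuousAt m (y t)) (hU : U ∈ 𝓝 (y t))
    (hae : ∀ᵐ z : E, z ∈ U → inner ℝ (gradient F z) (D z) ≤ m z)
    (hy : HasDerivAt y v' t) (hd : HasDerivAt (fun s => F (y s)) d t) :
    d ≤ m (y t) + K * ‖v' - D (y t)‖ := by
  refine deriv_comp_le_of_ae_inner_gradient_le hr hF (fun η hη => ?_) hy hd
  have hc : ContinuousAt (fun z => m z + K * ‖D (y t) - D z‖) (y t) :=
    hm.add ((continuousAt_const.sub hD).norm.const_mul _)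
  have h1 : ∀ᶠ z in 𝓝 (y t), m z + K * ‖D (y t) - D z‖ < m (y t) + η :=
    hc.eventually_lt continuousAt_const (by simpa using hη)
  obtain ⟨ρ, hρ, hsub⟩ := Metric.eventually_nhds_iff_ball.1
    ((h1.and hU).and (Metric.ball_mem_nhds (y t) hr))
  refine ⟨ρ, hρ, ?_⟩
  filter_upwards [hae] with z hz hzρ
  obtain ⟨⟨h2, h3⟩, h4⟩ := hsub z hzρ
  have h5 := norm_gradient_le_of_lipschitzOn (Metric.isOpen_ball.mem_nhds h4) hF
  -- The direction is frozen at `y t`. Gradients have norm at most `K`, so the error vanishes as `z`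
  -- approaches `y t` by continuity of `D`.
  have h6 : inner ℝ (gradient F z) (D (y t)) =
      inner ℝ (gradient F z) (D z) + inner ℝ (gradient F z) (D (y t) - D z) := by
    rw [← inner_add_right]; congr 1; abel
  have h7 : inner ℝ (gradient F z) (D (y t) - D z) ≤ K * ‖D (y t) - D z‖ :=
    (real_inner_le_norm _ _).trans (by gcongr)
  rw [h6]
  linarith [hz h3]

end Directional

/-- The terms in `γ² W²` cancel, `-H² + 2χWH - χ²W²` is the negative square `-(H - χW)²`, and `2(Λ -
L) ≥ ε` turns the remainder into `-ε χ W²`. -/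
theorem lyapunov_algebra {ε γ L Λ v W H χ α tol KV KW dV dW MW Mχ : ℝ} (hΛ : L + ε / 2 ≤ Λ)
    (hχ : 0 < χ) (hW : 0 ≤ W) (hWM : W ≤ MW) (hχM : χ ≤ Mχ) (hKW : 0 ≤ KW) (htol : 0 ≤ tol)
    (hdV : dV ≤ -ε * v - H ^ 2 + γ ^ 2 * W ^ 2 + α + KV * tol)
    (hdW : dW ≤ L * W + H + KW * tol) :
    dV + ((-2 * Λ * χ - χ ^ 2 - γ ^ 2) * W ^ 2 + χ * (2 * W * dW)) ≤
      -ε * (v + χ * W ^ 2) + (α + (KV + 2 * Mχ * MW * KW) * tol) := by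
  have h1 : χ * (2 * W * dW) ≤ χ * (2 * W * (L * W + H + KW * tol)) := by gcongr
  have h2 : χ * W * (KW * tol) ≤ Mχ * MW * (KW * tol) := by
    have := hχ.trans_le hχM
    gcongr
  have h3 : 0 ≤ χ * W ^ 2 * (2 * (Λ - L) - ε) := by
    have : 0 ≤ 2 * (Λ - L) - ε := by linarith
    positivity
  nlinarith [sq_nonneg (H - χ * W)]

/-- Comparison function of the scalar linear equation `B' = -ε B + m`, `B(0) = v`. -/
def comparison (ε m v s : ℝ) : ℝ := Real.exp (-ε * s) * (v - m / ε) + m / ε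

theorem comparison_eq {ε m v s : ℝ} : comparison ε m v s =
    Real.exp (-ε * s) * v + (1 - Real.exp (-ε * s)) * (m / ε) := by
  rw [comparison]; ring

variable {p q nu nw : ℕ}

theorem Loop.continuous_snd_slice {P : Loop p q nu nw}
    (hf : Continuous fun z : XVec p q × XVec p q × Vec nw => P.f z.1 z.2.1 z.2.2)
    (x : XVec p q) (w : Vec nw) : Continuous fun e => P.f x e w :=
  hf.comp (f := fun e : XVec p q => (x, e, w)) (by fun_prop)

theorem Loop.continuous_fst_slice {P : Loop p q nu nw}
    (hf : Continuous fun z : XVec p q × XVec p q × Vec nw => P.f z.1 z.2.1 z.2.2)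
    (e : XVec p q) (w : Vec nw) : Continuous fun x => P.f x e w :=
  hf.comp (f := fun x : XVec p q => (x, e, w)) (by fun_prop)

/-- Estimate of `V` along approximate solutions of the flow that start at a sampling instant in the
interior of `{V ≤ c}`. -/
theorem LocalHybridLyapunov.exists_flow_estimate {P : Loop p q nu nw}
    (hf : Continuous fun z : XVec p q × XVec p q × Vec nw => P.f z.1 z.2.1 z.2.2)
    {wbar : ℝ} {V : XVec p q → ℝ} {αw : ℝ → ℝ} {c ε γ L Λ : ℝ}
    (h : LocalHybridLyapunov P wbar V αw c ε γ L) (hε : ε ≠ 0) (hΛ : L + ε / 2 ≤ Λ)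
    {a b : ℝ} (hab : a ≤ b) {χ : ℝ → ℝ}
    (hχ : ∀ t ∈ Icc a b, 0 < χ t ∧ HasDerivAt χ (-2 * Λ * χ t - χ t ^ 2 - γ ^ 2) t) (R : ℝ) :
    ∃ K : ℝ, 0 ≤ K ∧ ∀ (w : ℝ → Vec nw) (y : ℝ → XVec p q) (tol : ℝ), 0 ≤ tol →
      (∀ t ∈ Icc a b, ‖w t‖ ≤ wbar) → AbsolutelyContinuousOnInterval y a b →
      (∀ t ∈ Icc a b, ‖y t‖ ≤ R) → V (y a) < c →
      (∀ᵐ t, t ∈ Ioo a b → ∃ v, HasDerivAt y v t ∧ ‖v - P.f (y t) (y a - y t) (w t)‖ ≤ tol) →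
      (∀ t ∈ Icc a b, comparison ε (αw wbar + K * tol) (V (y a)) (t - a) < c) →
      ∀ t ∈ Icc a b, V (y t) ≤ comparison ε (αw wbar + K * tol) (V (y a)) (t - a) := by
  obtain ⟨W, H, hW0, hWlip, ⟨α₁, α₂, hα₁, hα₂, hWα⟩, hH0, hHc, hWineq, hVineq⟩ := h.exists_W_H
  have hVlip := h.V_locallyLipschitz
  have hVc := hVlip.continuous
  have hWc := hWlip.continuous
  have hWzero : W 0 = 0 := by
    have := (hWα 0).2
    rw [norm_zero, hα₂.map_zero] at this
    exact le_antisymm this (hW0 0)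
  obtain ⟨KV, hKV⟩ := exists_lipschitzOnWith_closedBall hVlip (R + 1)
  obtain ⟨KW, hKW⟩ := exists_lipschitzOnWith_closedBall hWlip (2 * R + 1)
  obtain ⟨MW, hMW⟩ := (isCompact_closedBall (0 : XVec p q) (2 * R)).bddAbove_image hWc.continuousOn
  have hχc : ContinuousOn χ (Icc a b) := fun t ht => (hχ t ht).2.continuousAt.continuousWithinAt
  obtain ⟨Mχ, hMχ⟩ := isCompact_Icc.bddAbove_image hχc
  have hχac : AbsolutelyContinuousOnInterval χ a b := by
    have hχ'c : ContinuousOn (fun t => -2 * Λ * χ t - χ t ^ 2 - γ ^ 2) (Icc a b) := by fun_prop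
    obtain ⟨Kχ, hKχ⟩ := isCompact_Icc.exists_bound_of_continuousOn hχ'c
    refine LipschitzOnWith.absolutelyContinuousOnInterval (K := Real.toNNReal Kχ) ?_
    rw [uIcc_of_le hab]
    refine (convex_Icc a b).lipschitzOnWith_of_nnnorm_hasDerivWithin_le
      (fun t ht => (hχ t ht).2.hasDerivWithinAt) fun t ht => ?_
    rw [← NNReal.coe_le_coe, coe_nnnorm]
    exact (hKχ t ht).trans (Real.le_coe_toNNReal _)
  -- This constant depends on the radius `R` but not on the curve `y`, so that the estimate survives
  -- a limit of approximate arcs.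
  refine ⟨|KV + 2 * Mχ * MW * KW|, abs_nonneg _, ?_⟩
  intro w y tol htol hw hyac hyR hya hyder hB
  set K := |KV + 2 * Mχ * MW * KW|
  set m := αw wbar + K * tol with hm
  set e : ℝ → XVec p q := fun t => y a - y t with he
  have haI : a ∈ Icc a b := left_mem_Icc.2 hab
  have heR : ∀ t ∈ Icc a b, ‖e t‖ ≤ 2 * R := fun t ht => by
    have := norm_sub_le (y a) (y t)
    have := hyR a haI
    have := hyR t ht
    simp only [he]; linarith
  have hyc : ContinuousOn y (Icc a b) := by simpa [uIcc_of_le hab] using hyac.continuousOn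
  set U : ℝ → ℝ := fun t => V (y t) + χ t * W (e t) ^ 2 with hU
  set G : ℝ → ℝ := fun t => Real.exp (ε * (t - a)) * (U t - m / ε) with hG
  have hVac : AbsolutelyContinuousOnInterval (fun t => V (y t)) a b := by
    refine lipschitzOnWith_comp_absolutelyContinuous hKV hyac fun t ht => ?_
    rw [uIcc_of_le hab] at ht
    simpa using (hyR t ht).trans (by linarith)
  have hWac : AbsolutelyContinuousOnInterval (fun t => W (e t)) a b := by
    have heac : AbsolutelyContinuousOnInterval e a b :=
      lipschitzOnWith_comp_absolutelyContinuous (g := fun z : XVec p q => y a - z) (K := 1) (s := univ)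
        (LipschitzOnWith.of_dist_le_mul fun _ _ _ _ => by rw [dist_sub_left]; simp) hyac (mapsTo_univ _ _)
    refine lipschitzOnWith_comp_absolutelyContinuous hKW heac fun t ht => ?_
    rw [uIcc_of_le hab] at ht
    simpa using (heR t ht).trans (by linarith)
  have hGac : AbsolutelyContinuousOnInterval G a b := by
    have h1 : AbsolutelyContinuousOnInterval (fun t => Real.exp (ε * (t - a))) a b := by
      refine ContDiffOn.absolutelyContinuousOnInterval (ContDiff.contDiffOn ?_)
      fun_prop
    have h2 : AbsolutelyContinuousOnInterval (fun _ : ℝ => m / ε) a b :=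
      ContDiffOn.absolutelyContinuousOnInterval contDiffOn_const
    have h3 : AbsolutelyContinuousOnInterval U a b := by
      have := hVac.fun_add (hχac.fun_mul (hWac.fun_mul hWac))
      simpa only [hU, sq] using this
    exact h1.fun_mul (h3.fun_sub h2)
  have hUge : ∀ t ∈ Icc a b, V (y t) ≤ U t := fun t ht => by
    have := (hχ t ht).1
    have : 0 ≤ χ t * W (e t) ^ 2 := by positivity
    simp only [hU]; linarith
  have hGa : G a = V (y a) - m / ε := by simp [hG, hU, he, hWzero]
  -- The rescaled function `G` is nonincreasing as long as `V < c`: strictness makes the gradient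
  -- inequalities available almost everywhere on a neighbourhood.
  have hstep : ∀ t₁ ∈ Icc a b, (∀ t ∈ Ico a t₁, V (y t) < c) →
      V (y t₁) ≤ comparison ε m (V (y a)) (t₁ - a) := by
    intro t₁ ht₁ hlt
    have hGle : G t₁ - G a ≤ 0 * (t₁ - a) := by
      refine sub_le_of_absolutelyContinuous_of_ae_deriv_le ht₁.1 (hGac.mono ?_) ?_
      · rw [uIcc_of_le ht₁.1, uIcc_of_le hab]; exact Icc_subset_Icc_right ht₁.2
      filter_upwards [hyder, hVac.ae_differentiableAt, hWac.ae_differentiableAt]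
        with t h1 h2 h3 ht g hg
      have htI : t ∈ Icc a b := ⟨ht.1.le, ht.2.le.trans ht₁.2⟩
      obtain ⟨v, hv, hvtol⟩ := h1 ⟨ht.1, ht.2.trans_le ht₁.2⟩
      change ‖v - P.f (y t) (e t) (w t)‖ ≤ tol at hvtol
      have hdV := (h2 (by rwa [uIcc_of_le hab])).hasDerivAt
      have hdW := (h3 (by rwa [uIcc_of_le hab])).hasDerivAt
      set dV := deriv (fun t => V (y t)) t
      set dW := deriv (fun t => W (e t)) t
      have hVt : V (y t) < c := hlt t ⟨ht.1.le, ht.2⟩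
      have hye : y t + e t = y a := by simp [he]
      have hwt := hw t htI
      have bV : dV ≤ (-ε * V (y t) - H (y t) (e t) (w t) ^ 2 + γ ^ 2 * W (e t) ^ 2 + αw ‖w t‖)
          + KV * ‖v - P.f (y t) (e t) (w t)‖ := by
        refine deriv_comp_le_of_field (F := V) (D := fun x => P.f x (e t) (w t))
          (m := fun x => -ε * V x - H x (e t) (w t) ^ 2 + γ ^ 2 * W (e t) ^ 2 + αw ‖w t‖)
          (U := {x | V x < c ∧ V (x + e t) < c}) (y := y) one_pos
          (hKV.mono ?_) (Loop.continuous_fst_slice hf _ _).continuousAt ?_ ?_ ?_ hv hdV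
        · intro z hz
          have := hyR t htI
          rw [mem_ball_iff_norm] at hz
          rw [mem_closedBall_zero_iff]
          linarith [norm_le_norm_add_norm_sub' z (y t)]
        · have : Continuous fun x => H x (e t) (w t) :=
            hHc.comp_continuous (f := fun x : XVec p q => (x, e t, w t)) (by fun_prop)
              (fun _ => hwt)
          exact Continuous.continuousAt (by fun_prop)
        · refine IsOpen.mem_nhds (IsOpen.and ?_ ?_) ⟨hVt, by rw [hye]; exact hya⟩
          · exact isOpen_lt hVc continuous_const
          · exact isOpen_lt (by fun_prop) continuous_const
        · filter_upwards [hVineq (e t) (w t) hwt] with x hx hxU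
          exact hx hxU.1.le hxU.2.le
      have bW : dW ≤ (L * W (e t) + H (y t) (e t) (w t)) + KW * ‖-v - P.g (y t) (e t) (w t)‖ := by
        refine deriv_comp_le_of_field (F := W) (D := fun z => P.g (y t) z (w t))
          (m := fun z => L * W z + H (y t) z (w t))
          (U := {z | V (y t + z) < c}) (y := e) one_pos
          (hKW.mono ?_) (Loop.continuous_snd_slice hf _ _).neg.continuousAt ?_ ?_ ?_
          (hv.const_sub (y a)) hdW
        · intro z hz
          have := heR t htI
          rw [mem_ball_iff_norm] at hz
          rw [mem_closedBall_zero_iff]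
          linarith [norm_le_norm_add_norm_sub' z (e t)]
        · have : Continuous fun z => H (y t) z (w t) :=
            hHc.comp_continuous (f := fun z : XVec p q => (y t, z, w t)) (by fun_prop)
              (fun _ => hwt)
          exact Continuous.continuousAt (by fun_prop)
        · exact IsOpen.mem_nhds (isOpen_lt (by fun_prop) continuous_const)
            (show V (y t + e t) < c by rw [hye]; exact hya)
        · filter_upwards [hWineq (y t) hVt.le (w t) hwt] with z hz hzU
          exact hz (le_of_lt hzU)
      have hneg : ‖-v - P.g (y t) (e t) (w t)‖ = ‖v - P.f (y t) (e t) (w t)‖ := by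
        rw [Loop.g, ← norm_neg]; congr 1; abel
      rw [hneg] at bW
      have hα : αw ‖w t‖ ≤ αw wbar := h.αw_classKInf.strictMonoOn.monotoneOn (norm_nonneg _)
        ((norm_nonneg _).trans hwt) hwt
      have hWM : W (e t) ≤ MW :=
        hMW (mem_image_of_mem W (by simpa using heR t htI))
      have hχM : χ t ≤ Mχ := hMχ (mem_image_of_mem χ htI)
      have key := lyapunov_algebra (v := V (y t)) (W := W (e t)) (H := H (y t) (e t) (w t))
        (γ := γ) (α := αw wbar) (tol := tol) (KV := KV) (KW := KW) (dV := dV) (dW := dW)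
        hΛ (hχ t htI).1 (hW0 _) hWM hχM KW.2 htol
        (bV.trans (by linarith [mul_le_mul_of_nonneg_left hvtol KV.coe_nonneg]))
        (bW.trans (by linarith [mul_le_mul_of_nonneg_left hvtol KW.coe_nonneg]))
      have hdU : HasDerivAt U (dV + ((-2 * Λ * χ t - χ t ^ 2 - γ ^ 2) * W (e t) ^ 2 +
          χ t * (2 * W (e t) * dW))) t := by
        have := hdV.add ((hχ t htI).2.mul (hdW.pow 2))
        convert! this using 1
        simp
      set dU := dV + ((-2 * Λ * χ t - χ t ^ 2 - γ ^ 2) * W (e t) ^ 2 + χ t * (2 * W (e t) * dW))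
      have hexp : HasDerivAt (fun t => Real.exp (ε * (t - a))) (Real.exp (ε * (t - a)) * ε) t := by
        have := (((hasDerivAt_id t).sub_const a).const_mul ε).exp
        simpa using this
      have hdG := hexp.mul (hdU.sub_const (m / ε))
      rw [hg.unique hdG]
      have hK : (KV + 2 * Mχ * MW * KW) * tol ≤ K * tol :=
        mul_le_mul_of_nonneg_right (le_abs_self _) htol
      have : dU ≤ -ε * U t + m := by simp only [hU, hm]; linarith
      have h0 : Real.exp (ε * (t - a)) * ε * (U t - m / ε) + Real.exp (ε * (t - a)) * dU =
          Real.exp (ε * (t - a)) * (ε * U t - m + dU) := by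
        field_simp
      rw [h0]
      exact mul_nonpos_of_nonneg_of_nonpos (Real.exp_pos _).le (by linarith)
    have h1 : G t₁ ≤ V (y a) - m / ε := by rw [← hGa]; linarith
    have h2 : U t₁ - m / ε = Real.exp (-ε * (t₁ - a)) * G t₁ := by
      simp only [hG]
      rw [← mul_assoc, ← Real.exp_add]
      simp
    have h3 : Real.exp (-ε * (t₁ - a)) * G t₁ ≤ Real.exp (-ε * (t₁ - a)) * (V (y a) - m / ε) := by
      gcongr
    have h4 := hUge t₁ ht₁
    rw [comparison]
    linarith
  -- First-exit argument: at the first time with `c ≤ V`, the estimate up to that time already gives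
  -- `V < c`.
  have hlt : ∀ t ∈ Icc a b, V (y t) < c := by
    by_contra hcon
    push Not at hcon
    set S := {t ∈ Icc a b | c ≤ V (y t)} with hS
    have hSc : IsCompact S := by
      have hcl : IsClosed (Icc a b ∩ (fun t => V (y t)) ⁻¹' Ici c) :=
        (hVc.comp_continuousOn hyc).preimage_isClosed_of_isClosed isClosed_Icc isClosed_Ici
      exact isCompact_Icc.of_isClosed_subset hcl inter_subset_left
    obtain ⟨t₁, ht₁, hmin⟩ := hSc.exists_isLeast hcon
    have h1 := hstep t₁ ht₁.1 fun t ht => by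
      by_contra hct
      exact absurd (hmin ⟨⟨ht.1, ht.2.le.trans ht₁.1.2⟩, not_lt.1 hct⟩) (not_le.2 ht.2)
    exact absurd (h1.trans_lt (hB t₁ ht₁.1)) (not_lt.2 ht₁.2)
  exact fun t ht => hstep t ht fun s hs => hlt s ⟨hs.1, hs.2.le.trans ht.2⟩

end

section

variable {p q nu nw : ℕ}

/-! ### Flow arcs -/

/-- `x` is the plant and controller state along a flow that starts with a sampling instant at time
`a` and lasts until time `b`. -/
structure IsFlowArc (P : Loop p q nu nw) (wbar : ℝ) (w : ℝ → Vec nw) (x : ℝ → XVec p q)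
    (a b : ℝ) : Prop where
  bound : ∀ t ∈ Icc a b, ‖w t‖ ≤ wbar
  meas : AEStronglyMeasurable w (volume.restrict (Icc a b))
  absCont : AbsolutelyContinuousOnInterval x a b
  deriv : ∀ᵐ t, t ∈ Ioo a b → HasDerivAt x (P.f (x t) (x a - x t) (w t)) t

/-- The comparison function is a convex combination of `v` and `m / ε`, with positive weight on `v`.
-/
theorem comparison_lt {ε m v c s : ℝ} (hε : 0 < ε) (hs : 0 ≤ s) (hv : v < c) (hm : m / ε ≤ c) :
    comparison ε m v s < c := by
  rw [comparison_eq]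
  have h1 := Real.exp_pos (-ε * s)
  have h2 : Real.exp (-ε * s) ≤ 1 := Real.exp_le_one_iff.2 (by nlinarith)
  nlinarith

theorem IsFlowArc.continuousOn {P : Loop p q nu nw} {wbar a b : ℝ} {w : ℝ → Vec nw}
    {x : ℝ → XVec p q} (h : IsFlowArc P wbar w x a b) : ContinuousOn x (Icc a b) :=
  h.absCont.continuousOn.mono Icc_subset_uIcc

theorem IsFlowArc.exists_bound {P : Loop p q nu nw} {wbar a b : ℝ} {w : ℝ → Vec nw}
    {x : ℝ → XVec p q} (h : IsFlowArc P wbar w x a b) : ∃ R, 0 ≤ R ∧ ∀ t ∈ Icc a b, ‖x t‖ ≤ R := by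
  obtain ⟨R, hR⟩ := isCompact_Icc.exists_bound_of_continuousOn h.continuousOn
  exact ⟨|R|, abs_nonneg _, fun t ht => (hR t ht).trans (le_abs_self _)⟩

/-- The estimate of `V` for an arc that starts in the interior of `{V ≤ c}`. -/
theorem IsFlowArc.le_comparison {P : Loop p q nu nw}
    (hf : Continuous fun z : XVec p q × XVec p q × Vec nw => P.f z.1 z.2.1 z.2.2)
    {wbar : ℝ} {V : XVec p q → ℝ} {αw : ℝ → ℝ} {c ε γ L Λ : ℝ}
    (h : LocalHybridLyapunov P wbar V αw c ε γ L) (hε : ε ≠ 0) (hΛ : L + ε / 2 ≤ Λ)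
    {a b : ℝ} (hab : a ≤ b) {χ : ℝ → ℝ}
    (hχ : ∀ t ∈ Icc a b, 0 < χ t ∧ HasDerivAt χ (-2 * Λ * χ t - χ t ^ 2 - γ ^ 2) t)
    {w : ℝ → Vec nw} {x : ℝ → XVec p q} (hx : IsFlowArc P wbar w x a b) (hxa : V (x a) < c)
    (hB : ∀ t ∈ Icc a b, comparison ε (αw wbar) (V (x a)) (t - a) < c) :
    ∀ t ∈ Icc a b, V (x t) ≤ comparison ε (αw wbar) (V (x a)) (t - a) := by
  obtain ⟨R, -, hR⟩ := hx.exists_bound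
  obtain ⟨K, -, hK⟩ := h.exists_flow_estimate hf hε hΛ hab hχ R
  have := hK w x 0 le_rfl hx.bound hx.absCont hR hxa
    (by filter_upwards [hx.deriv] with t ht htI using ⟨_, ht htI, by simp⟩)
  simp only [mul_zero, add_zero] at this
  exact this hB

/-- The estimate of `V` for an arc that is a uniform limit of approximate arcs starting in the
interior of `{V ≤ c}`. -/
theorem IsFlowArc.le_comparison_of_approx {P : Loop p q nu nw}
    (hf : Continuous fun z : XVec p q × XVec p q × Vec nw => P.f z.1 z.2.1 z.2.2)
    {wbar : ℝ} {V : XVec p q → ℝ} {αw : ℝ → ℝ} {c ε γ L Λ : ℝ}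
    (h : LocalHybridLyapunov P wbar V αw c ε γ L) (hε : 0 < ε) (hΛ : L + ε / 2 ≤ Λ)
    {a b : ℝ} (hab : a ≤ b) {χ : ℝ → ℝ}
    (hχ : ∀ t ∈ Icc a b, 0 < χ t ∧ HasDerivAt χ (-2 * Λ * χ t - χ t ^ 2 - γ ^ 2) t)
    {w : ℝ → Vec nw} {x : ℝ → XVec p q} (hx : IsFlowArc P wbar w x a b)
    (happ : ∀ η > 0, ∀ K ≥ 0, ∃ (y : ℝ → XVec p q) (tol : ℝ), 0 ≤ tol ∧ tol ≤ η ∧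
      AbsolutelyContinuousOnInterval y a b ∧ (∀ t ∈ Icc a b, ‖y t - x t‖ ≤ η) ∧ V (y a) < c ∧
      (∀ᵐ t, t ∈ Ioo a b → ∃ v, HasDerivAt y v t ∧ ‖v - P.f (y t) (y a - y t) (w t)‖ ≤ tol) ∧
      ∀ t ∈ Icc a b, comparison ε (αw wbar + K * tol) (V (y a)) (t - a) < c) :
    ∀ t ∈ Icc a b, V (x t) ≤ comparison ε (αw wbar) (V (x a)) (t - a) := by
  obtain ⟨R, hR0, hR⟩ := hx.exists_bound
  -- `K` is fixed before the approximate arc is chosen; radius `R + 1` covers every arc within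
  -- distance `η < 1` of `x`.
  obtain ⟨K, hK0, hK⟩ := h.exists_flow_estimate hf hε.ne' hΛ hab hχ (R + 1)
  obtain ⟨KV, hKV⟩ := exists_lipschitzOnWith_closedBall h.V_locallyLipschitz (R + 1)
  intro t ht
  set E := Real.exp (-ε * (t - a)) with hE
  have hE1 : E ≤ 1 := Real.exp_le_one_iff.2 (by nlinarith [ht.1])
  have hE0 : 0 < E := Real.exp_pos _
  have hbound : ∀ η ∈ Ioo (0 : ℝ) 1, V (x t) ≤
      comparison ε (αw wbar + K * η) (V (x a) + KV * η) (t - a) + KV * η := by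
    intro η hη
    obtain ⟨y, tol, htol0, htol, hyac, hyx, hya, hyd, hyc⟩ := happ η hη.1 K hK0
    have hyR : ∀ t ∈ Icc a b, ‖y t‖ ≤ R + 1 := fun t ht => by
      have := norm_le_norm_add_norm_sub' (y t) (x t)
      linarith [hyx t ht, hR t ht, hη.2]
    have h1 := hK w y tol htol0 hx.bound hyac hyR hya hyd hyc t ht
    have hL : ∀ s ∈ Icc a b, |V (y s) - V (x s)| ≤ KV * η := fun s hs => by
      have := hKV.dist_le_mul (y s) (by simpa using hyR s hs) (x s)
        (by simpa using (hR s hs).trans (by linarith))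
      rw [Real.dist_eq, dist_eq_norm] at this
      exact this.trans (mul_le_mul_of_nonneg_left (hyx s hs) KV.coe_nonneg)
    have h2 := (abs_le.1 (hL t ht)).1
    have h3 := (abs_le.1 (hL a (left_mem_Icc.2 hab))).2
    have h4 : comparison ε (αw wbar + K * tol) (V (y a)) (t - a) ≤
        comparison ε (αw wbar + K * η) (V (x a) + KV * η) (t - a) := by
      rw [comparison_eq, comparison_eq]
      have : 0 ≤ 1 - E := by linarith
      rw [← hE]
      gcongr
      linarith
    linarith
  have hcont : Continuous fun η : ℝ =>
      comparison ε (αw wbar + K * η) (V (x a) + KV * η) (t - a) + KV * η := by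
    unfold comparison; fun_prop
  have htend := (hcont.tendsto 0).mono_left (nhdsWithin_le_nhds (s := Ioi 0))
  simp only [mul_zero, add_zero] at htend
  refine ge_of_tendsto htend ?_
  filter_upwards [Ioo_mem_nhdsGT (zero_lt_one' ℝ)] with η hη using hbound η hη

theorem exists_small_of_not_isLocalMin {V : XVec p q → ℝ} {z : XVec p q} {c : ℝ} (hz : V z = c)
    (hmin : ¬ IsLocalMin V z) {ρ : ℝ} (hρ : 0 < ρ) : ∃ d, ‖d‖ < ρ ∧ V (z + d) < c := by
  have h1 : ∃ᶠ y in 𝓝 z, V y < V z := by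
    rw [IsLocalMin, IsMinFilter, Filter.not_eventually] at hmin
    exact hmin.mono fun y hy => not_le.1 hy
  obtain ⟨y, hy, hyρ⟩ := (h1.and_eventually (Metric.ball_mem_nhds z hρ)).exists
  exact ⟨y - z, by simpa [dist_eq_norm] using hyρ, by simpa [hz] using hy⟩

/-- Approximate arcs for a continuous right-hand side: translates of the given arc. -/
theorem IsFlowArc.exists_translate {P : Loop p q nu nw}
    (hf : Continuous fun z : XVec p q × XVec p q × Vec nw => P.f z.1 z.2.1 z.2.2)
    {wbar a b : ℝ} (hab : a ≤ b) {w : ℝ → Vec nw} {x : ℝ → XVec p q}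
    (hx : IsFlowArc P wbar w x a b) {tol : ℝ} (htol : 0 < tol) :
    ∃ ρ > 0, ∀ d : XVec p q, ‖d‖ < ρ → AbsolutelyContinuousOnInterval (fun t => x t + d) a b ∧
      ∀ᵐ t, t ∈ Ioo a b → ∃ v, HasDerivAt (fun t => x t + d) v t ∧
        ‖v - P.f (x t + d) ((x a + d) - (x t + d)) (w t)‖ ≤ tol := by
  obtain ⟨R, hR0, hR⟩ := hx.exists_bound
  have hcomp : IsCompact (Metric.closedBall (0 : XVec p q) (R + 1) ×ˢ
      Metric.closedBall (0 : XVec p q) (2 * R) ×ˢ Metric.closedBall (0 : Vec nw) wbar) :=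
    (isCompact_closedBall _ _).prod ((isCompact_closedBall _ _).prod (isCompact_closedBall _ _))
  have huc := hcomp.uniformContinuousOn_of_continuous hf.continuousOn
  rw [Metric.uniformContinuousOn_iff] at huc
  obtain ⟨ρ, hρ, h⟩ := huc tol htol
  refine ⟨min ρ 1, lt_min hρ one_pos, fun d hd => ⟨?_, ?_⟩⟩
  · exact lipschitzOnWith_comp_absolutelyContinuous (g := fun z : XVec p q => z + d) (K := 1) (s := univ)
      (LipschitzOnWith.of_dist_le_mul fun _ _ _ _ => by simp) hx.absCont (mapsTo_univ _ _)
  · filter_upwards [hx.deriv] with t ht htI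
    refine ⟨_, (ht htI).add_const d, ?_⟩
    have htI' := Ioo_subset_Icc_self htI
    have h1 := hR t htI'
    have h2 := hR a (left_mem_Icc.2 hab)
    have h3 : ‖x a - x t‖ ≤ 2 * R := (norm_sub_le _ _).trans (by linarith)
    have h4 : ‖x t + d‖ ≤ R + 1 :=
      (norm_add_le _ _).trans (by linarith [hd.le.trans (min_le_right _ _)])
    -- A translation leaves the error `x a - x t` unchanged, so only the first argument of `f`
    -- moves.
    have := h (x t, x a - x t, w t) (by simp [hx.bound t htI', h3]; linarith)
      (x t + d, x a - x t, w t) (by simp [hx.bound t htI', h3, h4])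
      (by simpa [Prod.dist_eq, hρ] using hd.trans_le (min_le_left _ _))
    rw [dist_eq_norm] at this
    rw [add_sub_add_right_eq_sub]
    exact this.le

end

section

variable {p q nu nw : ℕ}

/-! ### Approximate arcs by Picard iteration -/

section Picard

variable {P : Loop p q nu nw} {wbar a b R K : ℝ} {w : ℝ → Vec nw} {x : ℝ → XVec p q}
  {x₀ : XVec p q}

/-- One Picard step for the flow after a sampling instant at time `a` with state `x₀`. -/
def picardStep (P : Loop p q nu nw) (w : ℝ → Vec nw) (a : ℝ) (x₀ : XVec p q)
    (z : ℝ → XVec p q) (t : ℝ) : XVec p q :=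
  x₀ + ∫ s in a..t, P.f (z s) (x₀ - z s) (w s)

theorem intervalIntegrable_field
    (hf : Continuous fun z : XVec p q × XVec p q × Vec nw => P.f z.1 z.2.1 z.2.2)
    (hab : a ≤ b) (hw : ∀ t ∈ Icc a b, ‖w t‖ ≤ wbar)
    (hwm : AEStronglyMeasurable w (volume.restrict (Icc a b))) {z : ℝ → XVec p q}
    (hz : ContinuousOn z (Icc a b)) :
    IntervalIntegrable (fun s => P.f (z s) (x₀ - z s) (w s)) volume a b ∧
      ∃ M, ∀ s ∈ Icc a b, ‖P.f (z s) (x₀ - z s) (w s)‖ ≤ M := by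
  have hM : ∃ M, ∀ s ∈ Icc a b, ‖P.f (z s) (x₀ - z s) (w s)‖ ≤ M := by
    obtain ⟨R, hR⟩ := isCompact_Icc.exists_bound_of_continuousOn hz
    obtain ⟨R', hR'⟩ := isCompact_Icc.exists_bound_of_continuousOn (continuousOn_const (c := x₀) |>.sub hz)
    have hcomp : IsCompact (Metric.closedBall (0 : XVec p q) R ×ˢ
        Metric.closedBall (0 : XVec p q) R' ×ˢ Metric.closedBall (0 : Vec nw) wbar) :=
      (isCompact_closedBall _ _).prod ((isCompact_closedBall _ _).prod (isCompact_closedBall _ _))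
    obtain ⟨M, hM⟩ := hcomp.exists_bound_of_continuousOn hf.continuousOn
    exact ⟨M, fun s hs => hM (z s, x₀ - z s, w s)
      ⟨by simpa using hR s hs, by simpa using hR' s hs, by simpa using hw s hs⟩⟩
  refine ⟨?_, hM⟩
  obtain ⟨M, hM⟩ := hM
  rw [intervalIntegrable_iff_integrableOn_Icc_of_le hab]
  have hzm : AEStronglyMeasurable z (volume.restrict (Icc a b)) :=
    hz.aestronglyMeasurable measurableSet_Icc
  have hmeas := hf.comp_aestronglyMeasurable
    (hzm.prodMk ((aestronglyMeasurable_const (b := x₀)).sub hzm |>.prodMk hwm))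
  refine Integrable.of_bound (C := M) hmeas ?_
  rw [ae_restrict_iff' measurableSet_Icc]
  exact ae_of_all _ hM

theorem picardStep_props
    (hf : Continuous fun z : XVec p q × XVec p q × Vec nw => P.f z.1 z.2.1 z.2.2)
    (hab : a ≤ b) (hw : ∀ t ∈ Icc a b, ‖w t‖ ≤ wbar)
    (hwm : AEStronglyMeasurable w (volume.restrict (Icc a b))) {z : ℝ → XVec p q}
    (hz : ContinuousOn z (Icc a b)) :
    AbsolutelyContinuousOnInterval (picardStep P w a x₀ z) a b ∧
    ∀ᵐ t, t ∈ Icc a b →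
      HasDerivAt (picardStep P w a x₀ z) (P.f (z t) (x₀ - z t) (w t)) t := by
  obtain ⟨hi, M, hM⟩ := intervalIntegrable_field (x₀ := x₀) hf hab hw hwm hz
  constructor
  · refine LipschitzOnWith.absolutelyContinuousOnInterval (K := M.toNNReal) ?_
    rw [uIcc_of_le hab]
    refine LipschitzOnWith.of_dist_le_mul fun t ht s hs => ?_
    have hsub : ∀ r ∈ Icc a b, IntervalIntegrable (fun s => P.f (z s) (x₀ - z s) (w s))
        volume a r := fun r hr => hi.mono_set (by
      rw [uIcc_of_le hr.1, uIcc_of_le hab]; exact Icc_subset_Icc_right hr.2)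
    rw [picardStep, picardStep, dist_add_left, dist_eq_norm,
      intervalIntegral.integral_interval_sub_left (hsub t ht) (hsub s hs), Real.dist_eq]
    refine (intervalIntegral.norm_integral_le_of_norm_le_const fun r hr => hM r ?_).trans ?_
    · exact uIcc_subset_Icc hs ht (uIoc_subset_uIcc hr)
    · gcongr
      exact Real.le_coe_toNNReal _
  · filter_upwards [hi.ae_hasDerivAt_integral] with t ht htI
    rw [uIcc_of_le hab] at ht
    exact (ht htI a (left_mem_Icc.2 hab)).const_add x₀

theorem IsFlowArc.eq_picardStep
    (hf : Continuous fun z : XVec p q × XVec p q × Vec nw => P.f z.1 z.2.1 z.2.2)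
    (hab : a ≤ b) (hx : IsFlowArc P wbar w x a b) :
    ∀ t ∈ Icc a b, x t = picardStep P w a (x a) x t := by
  obtain ⟨h1, h2⟩ := picardStep_props (x₀ := x a) hf hab hx.bound hx.meas hx.continuousOn
  obtain ⟨C, hC⟩ := (hx.absCont.fun_sub h1).const_of_ae_hasDerivAt_zero (by
    filter_upwards [h2, hx.deriv, Measure.ae_ne volume a, Measure.ae_ne volume b]
      with t h3 h4 ha hb ht
    rw [uIcc_of_le hab] at ht
    have := (h4 ⟨lt_of_le_of_ne ht.1 ha.symm, lt_of_le_of_ne ht.2 hb⟩).sub (h3 ht)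
    rw [sub_self] at this
    exact this)
  rw [uIcc_of_le hab] at hC
  have hC0 : C = 0 := by
    rw [← hC a (left_mem_Icc.2 hab)]; simp [picardStep]
  intro t ht
  have := hC t ht
  rw [hC0] at this
  exact sub_eq_zero.1 this

/-- The bound is phrased with the weight `k exp (k (s - a))` because it integrates to `exp (k (t -
a)) - 1`, so exponentially weighted estimates reproduce themselves under a Picard step. -/
theorem norm_picardStep_sub_le
    (hf : Continuous fun z : XVec p q × XVec p q × Vec nw => P.f z.1 z.2.1 z.2.2)
    (hab : a ≤ b) (hw : ∀ t ∈ Icc a b, ‖w t‖ ≤ wbar)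
    (hwm : AEStronglyMeasurable w (volume.restrict (Icc a b))) {z z' : ℝ → XVec p q}
    {x₀' : XVec p q} (hz : ContinuousOn z (Icc a b)) (hz' : ContinuousOn z' (Icc a b))
    {k A : ℝ}
    (hb : ∀ s ∈ Icc a b, ‖P.f (z s) (x₀ - z s) (w s) - P.f (z' s) (x₀' - z' s) (w s)‖ ≤
      A * (k * Real.exp (k * (s - a)))) :
    ∀ t ∈ Icc a b, ‖picardStep P w a x₀ z t - picardStep P w a x₀' z' t‖ ≤
      ‖x₀ - x₀'‖ + A * (Real.exp (k * (t - a)) - 1) := by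
  intro t ht
  have hsub : Icc a t ⊆ Icc a b := Icc_subset_Icc_right ht.2
  have hi := (intervalIntegrable_field (x₀ := x₀) hf hab hw hwm hz).1.mono_set
    (c := a) (d := t) (by rwa [uIcc_of_le ht.1, uIcc_of_le hab])
  have hi' := (intervalIntegrable_field (x₀ := x₀') hf hab hw hwm hz').1.mono_set
    (c := a) (d := t) (by rwa [uIcc_of_le ht.1, uIcc_of_le hab])
  rw [picardStep, picardStep, add_sub_add_comm, ← intervalIntegral.integral_sub hi hi']
  refine (norm_add_le _ _).trans (add_le_add_right ?_ _)
  have hcont : Continuous fun s => A * (k * Real.exp (k * (s - a))) := by fun_prop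
  refine (intervalIntegral.norm_integral_le_of_norm_le ht.1
    (ae_of_all _ fun s hs => hb s (hsub (Ioc_subset_Icc_self hs)))
    (hcont.intervalIntegrable _ _)).trans (le_of_eq ?_)
  have hder : ∀ s ∈ uIcc a t, HasDerivAt (fun s => A * Real.exp (k * (s - a)))
      (A * (k * Real.exp (k * (s - a)))) s := fun s _ => by
    have := ((((hasDerivAt_id s).sub_const a).const_mul k).exp).const_mul A
    convert! this using 1
    simp only [id]
    ring
  rw [intervalIntegral.integral_eq_sub_of_hasDerivAt hder (hcont.intervalIntegrable _ _)]
  simp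
  ring

/-- Approximate arcs with arbitrarily small defect, for a right-hand side that is Lipschitz on
bounded sets. -/
theorem IsFlowArc.exists_approx_of_lipschitz
    (hf : Continuous fun z : XVec p q × XVec p q × Vec nw => P.f z.1 z.2.1 z.2.2)
    (hab : a ≤ b) (hx : IsFlowArc P wbar w x a b) (hxR : ∀ t ∈ Icc a b, ‖x t‖ + 1 ≤ R)
    (hK : 0 < K)
    (hlip : ∀ x x' e e' : XVec p q, ‖x‖ ≤ 2 * R → ‖x'‖ ≤ 2 * R → ‖e‖ ≤ 2 * R → ‖e'‖ ≤ 2 * R →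
      ∀ w : Vec nw, ‖w‖ ≤ wbar → ‖P.f x e w - P.f x' e' w‖ ≤ K * (‖x - x'‖ + ‖e - e'‖))
    {d : XVec p q} (hd : ‖d‖ * Real.exp (3 * K * (b - a)) ≤ 1) {tol : ℝ} (htol : 0 < tol) :
    ∃ y : ℝ → XVec p q, AbsolutelyContinuousOnInterval y a b ∧ y a = x a + d ∧
      (∀ t ∈ Icc a b, ‖y t - x t‖ ≤ ‖d‖ * Real.exp (3 * K * (b - a))) ∧
      ∀ᵐ t, t ∈ Ioo a b → ∃ v, HasDerivAt y v t ∧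
        ‖v - P.f (y t) (y a - y t) (w t)‖ ≤ tol := by
  set x₀ := x a + d with hx₀
  set Z : ℕ → ℝ → XVec p q := fun n => (picardStep P w a x₀)^[n] (fun t => x t + d) with hZ
  have hZsucc : ∀ n, Z (n + 1) = picardStep P w a x₀ (Z n) := fun n =>
    Function.iterate_succ_apply' _ _ _
  have hexp : ∀ (k : ℝ), 0 ≤ k → ∀ t ∈ Icc a b, 1 ≤ Real.exp (k * (t - a)) := fun k hk t ht =>
    Real.one_le_exp (mul_nonneg hk (sub_nonneg.2 ht.1))
  have haI : a ∈ Icc a b := left_mem_Icc.2 hab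
  have hd1 : ‖d‖ ≤ 1 := by
    have := hexp (3 * K) (by positivity) b (right_mem_Icc.2 hab)
    nlinarith [norm_nonneg d]
  have hx₀R : ‖x₀‖ ≤ R := (norm_add_le _ _).trans (by linarith [hxR a haI])
  have hmono : ∀ t ∈ Icc a b, ‖d‖ * Real.exp (3 * K * (t - a)) ≤
      ‖d‖ * Real.exp (3 * K * (b - a)) := fun t ht => by
    have := ht.2
    gcongr
  have hclose : ∀ z : XVec p q, ∀ t ∈ Icc a b, ‖z - x t‖ ≤ ‖d‖ * Real.exp (3 * K * (t - a)) →
      ‖z‖ ≤ R := fun z t ht h => by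
    have := norm_le_norm_add_norm_sub' z (x t)
    linarith [hmono t ht, hxR t ht]
  -- This tube around `x` is invariant: the state and error differences add up to at most three
  -- times its radius, whence the rate `3 * K`, and the `-1` left by the integral cancels the
  -- initial offset `‖d‖`.
  have hstep : ∀ n, ContinuousOn (Z n) (Icc a b) ∧
      ∀ t ∈ Icc a b, ‖Z n t - x t‖ ≤ ‖d‖ * Real.exp (3 * K * (t - a)) := by
    intro n
    induction n with
    | zero =>
      refine ⟨hx.continuousOn.add continuousOn_const, fun t ht => ?_⟩
      have := hexp (3 * K) (by positivity) t ht
      simp only [hZ, Function.iterate_zero, id, add_sub_cancel_left]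
      nlinarith [norm_nonneg d]
    | succ n ih =>
      rw [hZsucc]
      refine ⟨(picardStep_props hf hab hx.bound hx.meas ih.1).1.continuousOn.mono
        Icc_subset_uIcc, fun t ht => ?_⟩
      rw [hx.eq_picardStep hf hab t ht]
      refine (norm_picardStep_sub_le hf hab hx.bound hx.meas ih.1 hx.continuousOn
        (k := 3 * K) (A := ‖d‖) (fun s hs => ?_) t ht).trans (le_of_eq ?_)
      · have e1 := ih.2 s hs
        have e2 := hclose _ s hs e1
        have e3 := hxR s hs
        have e4 : ‖x₀ - Z n s‖ ≤ 2 * R := (norm_sub_le _ _).trans (by linarith)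
        have e5 : ‖x a - x s‖ ≤ 2 * R := (norm_sub_le _ _).trans (by linarith [hxR a haI])
        have hR0 : 0 ≤ R := (norm_nonneg _).trans hx₀R
        refine (hlip _ _ _ _ (by linarith) (by linarith) e4 e5 _ (hx.bound s hs)).trans ?_
        have e6 : ‖x₀ - Z n s - (x a - x s)‖ ≤ ‖d‖ + ‖Z n s - x s‖ := by
          rw [show x₀ - Z n s - (x a - x s) = d - (Z n s - x s) by rw [hx₀]; abel]
          exact norm_sub_le _ _
        have e7 := hexp (3 * K) (by positivity) s hs
        have e8 : ‖d‖ ≤ ‖d‖ * Real.exp (3 * K * (s - a)) := by nlinarith [norm_nonneg d]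
        calc K * (‖Z n s - x s‖ + ‖x₀ - Z n s - (x a - x s)‖)
            ≤ K * (3 * (‖d‖ * Real.exp (3 * K * (s - a)))) := by gcongr; linarith
          _ = _ := by ring
      · rw [hx₀, add_sub_cancel_left]; ring
  have hlip' : ∀ n, ∀ s ∈ Icc a b,
      ‖P.f (Z (n + 1) s) (x₀ - Z (n + 1) s) (w s) - P.f (Z n s) (x₀ - Z n s) (w s)‖ ≤
        2 * K * ‖Z (n + 1) s - Z n s‖ := by
    intro n s hs
    have e1 := hclose _ s hs ((hstep (n + 1)).2 s hs)
    have e2 := hclose _ s hs ((hstep n).2 s hs)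
    have hR0 : 0 ≤ R := (norm_nonneg _).trans hx₀R
    refine (hlip _ _ _ _ (by linarith) (by linarith) ((norm_sub_le _ _).trans (by linarith))
      ((norm_sub_le _ _).trans (by linarith)) _ (hx.bound s hs)).trans (le_of_eq ?_)
    rw [sub_sub_sub_cancel_left, norm_sub_rev (Z n s)]
    ring
  -- The field has Lipschitz constant `2 * K` in the curve, so the weight with rate `4 * K` makes
  -- every step a contraction by `1 / 2`.
  have hcauchy : ∀ n, ∀ t ∈ Icc a b,
      ‖Z (n + 1) t - Z n t‖ ≤ (1 / 2) ^ n * (2 * ‖d‖) * Real.exp (4 * K * (t - a)) := by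
    intro n
    induction n with
    | zero =>
      intro t ht
      have e1 := (hstep 1).2 t ht
      have e2 := (hstep 0).2 t ht
      have e3 : Real.exp (3 * K * (t - a)) ≤ Real.exp (4 * K * (t - a)) := by
        have := sub_nonneg.2 ht.1
        gcongr
        norm_num
      have e4 : ‖Z (0 + 1) t - Z 0 t‖ ≤ ‖Z 1 t - x t‖ + ‖Z 0 t - x t‖ := by
        rw [show Z (0 + 1) t - Z 0 t = (Z 1 t - x t) - (Z 0 t - x t) by simp]
        exact norm_sub_le _ _
      nlinarith [norm_nonneg d]
    | succ n ih =>
      intro t ht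
      have := norm_picardStep_sub_le (x₀ := x₀) (x₀' := x₀) hf hab hx.bound hx.meas
        (hstep (n + 1)).1 (hstep n).1
        (k := 4 * K) (A := (1 / 2) ^ (n + 1) * (2 * ‖d‖)) (fun s hs => by
          refine (hlip' n s hs).trans ?_
          have := ih s hs
          calc 2 * K * ‖Z (n + 1) s - Z n s‖
              ≤ 2 * K * ((1 / 2) ^ n * (2 * ‖d‖) * Real.exp (4 * K * (s - a))) := by gcongr
            _ = _ := by ring) t ht
      rw [← hZsucc, ← hZsucc] at this
      refine this.trans ?_
      rw [sub_self, norm_zero, zero_add]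
      gcongr
      linarith
  have htend : Tendsto (fun n : ℕ => 2 * K * ((1 / 2 : ℝ) ^ n * (2 * ‖d‖) *
      Real.exp (4 * K * (b - a)))) atTop (𝓝 0) := by
    have := tendsto_pow_atTop_nhds_zero_of_lt_one (r := (1 / 2 : ℝ)) (by norm_num) (by norm_num)
    have := (((this.mul_const (2 * ‖d‖)).mul_const (Real.exp (4 * K * (b - a)))).const_mul (2 * K))
    simpa using this
  obtain ⟨n, hn⟩ := (htend.eventually_lt_const htol).exists
  obtain ⟨h1, h2⟩ := picardStep_props (x₀ := x₀) hf hab hx.bound hx.meas (hstep n).1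
  rw [← hZsucc] at h1 h2
  have hZa : Z (n + 1) a = x₀ := by simp [hZsucc, picardStep]
  refine ⟨Z (n + 1), h1, hZa,
    fun t ht => ((hstep (n + 1)).2 t ht).trans (hmono t ht), ?_⟩
  filter_upwards [h2] with t ht htI
  have htI' := Ioo_subset_Icc_self htI
  refine ⟨_, ht htI', ?_⟩
  -- The iterate `Z (n + 1)` has velocity given by the field along `Z n`; its defect is thus
  -- controlled by the distance of consecutive iterates.
  rw [hZa, norm_sub_rev]
  refine ((hlip' n t htI').trans ?_).trans hn.le
  have := hcauchy n t htI'
  have h3 := htI'.2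
  refine mul_le_mul_of_nonneg_left (this.trans ?_) (by positivity)
  gcongr

end Picard

end

/-! ### Arcs that start on the boundary of a sublevel set -/

section

variable {p q nu nw : ℕ}

/-- The estimate of `V` for an arc that starts anywhere in `{V ≤ c}`, for `ε > 0`. -/
theorem IsFlowArc.le_comparison_of_pos {P : Loop p q nu nw}
    (hf : Continuous fun z : XVec p q × XVec p q × Vec nw => P.f z.1 z.2.1 z.2.2)
    {wbar : ℝ} {V : XVec p q → ℝ} {αw : ℝ → ℝ} {c ε γ L Λ : ℝ}
    (h : LocalHybridLyapunov P wbar V αw c ε γ L) (hε : 0 < ε) (hΛ : L + ε / 2 ≤ Λ)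
    {a b : ℝ} (hab : a ≤ b) {χ : ℝ → ℝ}
    (hχ : ∀ t ∈ Icc a b, 0 < χ t ∧ HasDerivAt χ (-2 * Λ * χ t - χ t ^ 2 - γ ^ 2) t)
    {w : ℝ → Vec nw} {x : ℝ → XVec p q} (hx : IsFlowArc P wbar w x a b) (hxa : V (x a) ≤ c)
    (hlevel : ∀ z, V z = c → ¬ IsLocalMin V z)
    (hreg : αw wbar / ε < c ∨ (αw wbar / ε ≤ c ∧ P.IsLipschitzOnBounded wbar)) :
    ∀ t ∈ Icc a b, V (x t) ≤ comparison ε (αw wbar) (V (x a)) (t - a) := by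
  have hαc : αw wbar / ε ≤ c := hreg.elim le_of_lt And.left
  rcases hxa.lt_or_eq with hlt | heq
  · exact hx.le_comparison hf h hε.ne' hΛ hab hχ hlt fun t ht =>
      comparison_lt hε (sub_nonneg.2 ht.1) hlt hαc
  refine hx.le_comparison_of_approx hf h hε hΛ hab hχ fun η hη K hK => ?_
  have hmin := hlevel _ heq
  rcases hreg with hstrict | ⟨-, hlip⟩
  · have hgap : 0 < ε * c - αw wbar := by
      rw [div_lt_iff₀ hε] at hstrict; linarith
    -- Small enough that `(αw wbar + K * tol) / ε ≤ c` still holds.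
    set tol := min η ((ε * c - αw wbar) / (K + 1)) with htol
    have htol0 : 0 < tol := lt_min hη (by positivity)
    obtain ⟨ρ, hρ, hd⟩ := hx.exists_translate hf hab htol0
    obtain ⟨d, hdρ, hdV⟩ := exists_small_of_not_isLocalMin heq hmin (lt_min hρ hη)
    obtain ⟨h1, h2⟩ := hd d (hdρ.trans_le (min_le_left _ _))
    refine ⟨fun t => x t + d, tol, htol0.le, min_le_left _ _, h1, fun t _ => ?_, hdV, h2,
      fun t ht => comparison_lt hε (sub_nonneg.2 ht.1) hdV ?_⟩
    · rw [add_sub_cancel_left]; exact (hdρ.trans_le (min_le_right _ _)).le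
    · have h3 : K * tol ≤ ε * c - αw wbar := by
        have : (K + 1) * tol ≤ ε * c - αw wbar := by
          rw [← le_div_iff₀' (by positivity)]; exact min_le_right _ _
        linarith
      rw [div_le_iff₀ hε]
      linarith
  · obtain ⟨R, hR0, hR⟩ := hx.exists_bound
    obtain ⟨K', hK'⟩ := hlip (2 * (R + 1))
    set k := max K' 1
    have hk : 0 < k := lt_max_of_lt_right one_pos
    have hklip : ∀ x x' e e' : XVec p q, ‖x‖ ≤ 2 * (R + 1) → ‖x'‖ ≤ 2 * (R + 1) →
        ‖e‖ ≤ 2 * (R + 1) → ‖e'‖ ≤ 2 * (R + 1) →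
        ∀ w : Vec nw, ‖w‖ ≤ wbar → ‖P.f x e w - P.f x' e' w‖ ≤ k * (‖x - x'‖ + ‖e - e'‖) := by
      intro x x' e e' h1 h2 h3 h4 w hw
      refine (hK' x x' e e' h1 h2 h3 h4 w hw).trans ?_
      gcongr
      exact le_max_left _ _
    set M := Real.exp (3 * k * (b - a))
    have hM : 0 < M := Real.exp_pos _
    obtain ⟨d, hdρ, hdV⟩ := exists_small_of_not_isLocalMin heq hmin
      (ρ := min 1 η / M) (by positivity)
    rw [lt_div_iff₀ hM] at hdρ
    set E := Real.exp (-ε * (b - a)) with hE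
    have hE0 : 0 < E := Real.exp_pos _
    set g := c - V (x a + d) with hg
    have hg0 : 0 < g := sub_pos.2 hdV
    -- The defect is chosen after `d`, since it must be small against the gap `g`. The comparison
    -- function retains at least `E * g` of that gap, which exceeds `K * tol / ε`.
    set tol := min η (E * g * ε / (K + 1) / 2) with htol
    have htol0 : 0 < tol := lt_min hη (by positivity)
    obtain ⟨y, h1, h2, h3, h4⟩ := hx.exists_approx_of_lipschitz hf hab (R := R + 1)
      (fun t ht => by linarith [hR t ht]) hk hklip (d := d)
      (hdρ.le.trans (min_le_left _ _)) htol0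
    refine ⟨y, tol, htol0.le, min_le_left _ _, h1,
      fun t ht => (h3 t ht).trans (hdρ.le.trans (min_le_right _ _)), by rwa [h2], h4,
      fun t ht => ?_⟩
    rw [h2, comparison_eq]
    have e1 : E ≤ Real.exp (-ε * (t - a)) := Real.exp_le_exp.2 (by nlinarith [ht.2])
    have e2 : Real.exp (-ε * (t - a)) ≤ 1 := Real.exp_le_one_iff.2 (by nlinarith [ht.1])
    have e3 : K * tol / ε < E * g := by
      rw [div_lt_iff₀ hε]
      have : (K + 1) * tol ≤ E * g * ε / 2 := by
        rw [← le_div_iff₀' (by positivity), div_right_comm]; exact min_le_right _ _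
      have : 0 < E * g * ε := by positivity
      linarith
    have e4 : (αw wbar + K * tol) / ε = αw wbar / ε + K * tol / ε := add_div _ _ _
    have e5 : 0 ≤ K * tol / ε := by positivity
    rw [e4]
    set X := Real.exp (-ε * (t - a))
    have e6 : V (x a + d) = c - g := by rw [hg]; ring
    rw [e6]
    have e7 : (1 - X) * (αw wbar / ε + K * tol / ε) ≤ (1 - X) * (c + K * tol / ε) := by
      have : 0 ≤ 1 - X := by linarith
      gcongr
    nlinarith

end

section

/-! ### The sampling mechanism -/

namespace Params

variable {npar nc : ℕ} {A : Params npar nc}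

/-- Meaning of a positive candidate interval. -/
theorem candidate_spec {aw v C s : ℝ} {l : Fin nc} {i : Fin npar} (haw : 0 < aw) (hv : 0 ≤ v)
    (hε : A.ε i l < 0) (hεref : 0 < A.εref) (hpos : 0 < A.candidate aw v C l i) (hs : 0 ≤ s)
    (hsc : s ≤ A.candidate aw v C l i) :
    v < C ∧ s ≤ A.δ * Tmax (A.γ i l) (max (A.L i l + A.ε i l / 2) (1 - A.δ)) ∧
      comparison (A.ε i l) aw v s ≤ Real.exp (-A.εref * s) * C ∧
      comparison (A.ε i l) aw v s < C := by
  have hvC : v ≤ C := by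
    by_contra hcon
    simp [candidate, hcon] at hpos
  have hD : 0 < -A.ε i l + A.εref := by linarith
  simp only [candidate, if_pos hvC, if_pos hD, lt_min_iff, le_min_iff] at hpos hsc
  obtain ⟨-, hpos⟩ := hpos
  obtain ⟨hsT, hsc⟩ := hsc
  have ha : aw / A.ε i l < 0 := div_neg_of_pos_of_neg haw hε
  have hp : 0 < v - aw / A.ε i l := by linarith
  have hP : 0 < C - aw / A.ε i l := by linarith
  have hvC' : v < C := by
    refine lt_of_le_of_ne hvC fun h => ?_
    rw [h, sub_self, zero_div] at hpos
    exact lt_irrefl _ hpos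
  have hX1 : Real.exp (-A.εref * s) ≤ 1 := Real.exp_le_one_iff.2 (by nlinarith)
  have hX0 := Real.exp_pos (-A.εref * s)
  -- This is the exponential of the logarithmic bound in the mechanism. Adding the negative number
  -- `aw / ε` back then gives the bound by `exp (-εref s) * C`.
  have hkey : Real.exp (-A.ε i l * s) * (v - aw / A.ε i l) ≤
      Real.exp (-A.εref * s) * (C - aw / A.ε i l) := by
    rw [le_div_iff₀ hD] at hsc
    rw [← Real.exp_log hp, ← Real.exp_log hP, ← Real.exp_add, ← Real.exp_add]
    exact Real.exp_le_exp.2 (by linarith)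
  have hle : comparison (A.ε i l) aw v s ≤ Real.exp (-A.εref * s) * C := by
    rw [comparison]
    nlinarith
  refine ⟨hvC', hsT, hle, ?_⟩
  rcases hs.eq_or_lt with h0 | h0
  · rw [← h0]; simpa [comparison] using hvC'
  · have : Real.exp (-A.εref * s) < 1 := Real.exp_lt_one_iff.2 (by nlinarith)
    nlinarith

variable [NeZero npar]

theorem fallback_le_interval (aw v C : ℝ) (l : Fin nc) : A.fallback l ≤ A.interval aw v C l := by
  refine Eq.trans_le ?_ (Finset.le_sup' (fun i : Fin npar =>
    if i = 0 then A.fallback l else A.candidate aw v C l i) (Finset.mem_univ 0))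
  rw [if_pos rfl]

variable [NeZero nc]

theorem tMin_le_fallback (l : Fin nc) : A.tMin ≤ A.fallback l :=
  Finset.inf'_le _ (Finset.mem_univ l)

theorem tMin_pos (h : ∀ l, 0 < A.fallback l) : 0 < A.tMin :=
  (Finset.lt_inf'_iff _).2 fun l _ => h l

theorem tMin_le_algorithm (aw v C : ℝ) : A.tMin ≤ A.algorithm aw v C := by
  unfold algorithm
  split_ifs with h
  · exact (tMin_le_fallback _).trans (fallback_le_interval _ _ _ _)
  · exact le_rfl

/-- At an admissible value, the mechanism returns either the fall-back interval or a candidate. -/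
theorem algorithm_cases {aw v C : ℝ} (h : ∃ l, max v C ≤ A.c l) :
    ∃ l, max v C ≤ A.c l ∧ (A.algorithm aw v C = A.fallback l ∨
      ∃ i, i ≠ 0 ∧ A.algorithm aw v C = A.candidate aw v C l i ∧
        A.fallback l ≤ A.candidate aw v C l i) := by
  have hne : (A.levels v C).Nonempty := by
    obtain ⟨l, hl⟩ := h
    exact ⟨l, by simpa [levels] using hl⟩
  have hmem := Finset.min'_mem _ hne
  refine ⟨(A.levels v C).min' hne, by simpa [levels] using hmem, ?_⟩
  rw [algorithm, dif_pos hne]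
  set l := (A.levels v C).min' hne
  obtain ⟨i, -, hi⟩ := Finset.exists_mem_eq_sup' (Finset.univ_nonempty (α := Fin npar))
    (fun i : Fin npar => if i = 0 then A.fallback l else A.candidate aw v C l i)
  change A.interval aw v C l = _ at hi
  by_cases h0 : i = 0
  · left; rw [hi, if_pos h0]
  · right
    rw [if_neg h0] at hi
    exact ⟨i, h0, hi, hi ▸ fallback_le_interval _ _ _ _⟩

end Params

variable {p q nu nw npar nc : ℕ} [NeZero npar] [NeZero nc]

/-- Decay of `V` over one sampling interval chosen by the mechanism. -/
theorem IsFlowArc.decay {P : Loop p q nu nw}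
    (hf : Continuous fun z : XVec p q × XVec p q × Vec nw => P.f z.1 z.2.1 z.2.2)
    {wbar : ℝ} (hwbar : 0 < wbar) {V : XVec p q → ℝ} {αw : ℝ → ℝ} {A : Params npar nc}
    (hεref : 0 < A.εref) (hδ : A.δ ∈ Ioo (0 : ℝ) 1)
    (hA : ∀ (i : Fin npar) (l : Fin nc),
      LocalHybridLyapunov P wbar V αw (A.c l) (A.ε i l) (A.γ i l) (A.L i l))
    (hε1 : ∀ l, 0 < A.ε 0 l) (hεi : ∀ i, i ≠ 0 → ∀ l, A.ε i l < 0)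
    {cw : ℝ} (hcw : ∀ l, αw wbar / A.ε 0 l ≤ cw)
    (hlevel : ∀ l x, V x = A.c l → ¬ IsLocalMin V x)
    (hreg : (∀ l, αw wbar / A.ε 0 l < cw) ∨ P.IsLipschitzOnBounded wbar)
    {κ : ℝ} (hκ1 : ∀ l, κ ≤ A.ε 0 l) (hκ2 : κ ≤ A.εref)
    {a b η : ℝ} (hab : a ≤ b) (hη : 0 ≤ η)
    {w : ℝ → Vec nw} {x : ℝ → XVec p q} (hx : IsFlowArc P wbar w x a b)
    (hl : ∃ l, max (V (x a)) (cw + η) ≤ A.c l)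
    (hb : b - a ≤ A.algorithm (αw wbar) (V (x a)) (cw + η)) :
    ∀ t ∈ Icc a b, V (x t) - cw ≤
      Real.exp (-κ * (t - a)) * max (max (V (x a) - cw) 0) η := by
  have haw : 0 < αw wbar := by
    have hK := (hA 0 0).αw_classKInf
    have := hK.strictMonoOn (mem_Ici.2 le_rfl) (mem_Ici.2 hwbar.le) hwbar
    rwa [hK.map_zero] at this
  have hcw0 : 0 < cw := (div_pos haw (hε1 0)).trans_le (hcw 0)
  intro t ht
  have hs : 0 ≤ t - a := sub_nonneg.2 ht.1
  obtain ⟨l, hlc, hcase⟩ := Params.algorithm_cases (aw := αw wbar) hl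
  have hvc : V (x a) ≤ A.c l := (le_max_left _ _).trans hlc
  have hCc : cw + η ≤ A.c l := (le_max_right _ _).trans hlc
  have hΛ0 : 0 < A.L 0 l + A.ε 0 l / 2 := by
    have := (hA 0 l).L_pos
    have := hε1 l
    positivity
  rcases hcase with hfb | ⟨i, hi0, hcand, hfb⟩
  · rw [hfb] at hb
    obtain ⟨χ, hχ⟩ := exists_riccati_on_Icc (hA 0 l).γ_pos hΛ0 hδ hb
    have hα : αw wbar / A.ε 0 l < A.c l ∨
        (αw wbar / A.ε 0 l ≤ A.c l ∧ P.IsLipschitzOnBounded wbar) := by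
      rcases hreg with h | h
      · left; linarith [h l]
      · right; exact ⟨by linarith [hcw l], h⟩
    have h1 := hx.le_comparison_of_pos hf (hA 0 l) (hε1 l) le_rfl hab hχ hvc (hlevel l) hα t ht
    rw [comparison_eq] at h1
    set X := Real.exp (-A.ε 0 l * (t - a)) with hX
    have hX0 : 0 < X := Real.exp_pos _
    have hX1 : X ≤ 1 := Real.exp_le_one_iff.2 (by nlinarith [hε1 l])
    have h2 : (1 - X) * (αw wbar / A.ε 0 l) ≤ (1 - X) * cw := by
      have : 0 ≤ 1 - X := by linarith
      gcongr
      exact hcw l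
    have h3 : V (x t) - cw ≤ X * (V (x a) - cw) := by linarith
    refine h3.trans ?_
    have h4 : X ≤ Real.exp (-κ * (t - a)) := Real.exp_le_exp.2 (by nlinarith [hκ1 l])
    have h5 : V (x a) - cw ≤ max (max (V (x a) - cw) 0) η :=
      (le_max_left _ _).trans (le_max_left _ _)
    have h6 : 0 ≤ max (max (V (x a) - cw) 0) η := hη.trans (le_max_right _ _)
    calc X * (V (x a) - cw) ≤ X * max (max (V (x a) - cw) 0) η := by gcongr
      _ ≤ _ := by gcongr
  · rw [hcand] at hb
    -- A selected candidate is at least the positive fall-back interval. Hence `V < C ≤ c_l`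
    -- strictly at the start, and no approximation is needed for `ε < 0`.
    have hpos : 0 < A.candidate (αw wbar) (V (x a)) (cw + η) l i := by
      refine lt_of_lt_of_le ?_ hfb
      exact mul_pos hδ.1 (Tmax_pos_and_exists_riccati (hA 0 l).γ_pos hΛ0).1
    have hspec := fun s hs hs' => Params.candidate_spec (s := s) haw ((hA 0 0).V_nonneg (x a))
      (hεi i hi0 l) hεref hpos hs hs'
    obtain ⟨hvC, hT, -, -⟩ := hspec (b - a) (sub_nonneg.2 hab) hb
    have hΛ : 0 < max (A.L i l + A.ε i l / 2) (1 - A.δ) :=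
      lt_max_of_lt_right (sub_pos.2 hδ.2)
    obtain ⟨χ, hχ⟩ := exists_riccati_on_Icc (hA i l).γ_pos hΛ hδ hT
    have h1 := hx.le_comparison hf (hA i l) (hεi i hi0 l).ne (le_max_left _ _) hab hχ
      (hvC.trans_le hCc)
      (fun s hs => ((hspec (s - a) (sub_nonneg.2 hs.1) (by linarith [hs.2])).2.2.2).trans_le hCc)
      t ht
    have h2 := (hspec (t - a) hs (by linarith [ht.2])).2.2.1
    set X := Real.exp (-A.εref * (t - a)) with hX
    have hX0 : 0 < X := Real.exp_pos _
    have hX1 : X ≤ 1 := Real.exp_le_one_iff.2 (by nlinarith)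
    -- Because `X * (cw + η) - cw = X * η - (1 - X) * cw` with `0 < cw`.
    have h3 : V (x t) - cw ≤ X * η := by nlinarith
    refine h3.trans ?_
    have h4 : X ≤ Real.exp (-κ * (t - a)) := Real.exp_le_exp.2 (by nlinarith)
    gcongr
    exact le_max_right _ _

end

/-! ### Hybrid time domains and hybrid arcs -/

namespace IsHybridTimeDomain

variable {E : Set (ℝ × ℕ)}

theorem mem_of_mem_Icc (hE : IsHybridTimeDomain E) {s t r : ℝ} {j : ℕ} (hs : (s, j) ∈ E)
    (ht : (t, j) ∈ E) (hr : r ∈ Icc s t) : (r, j) ∈ E := by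
  obtain ⟨J, T, -, -, h⟩ := hE.compact _ ht
  have h1 : (s, j) ∈ E ∩ {q | 0 ≤ q.1 ∧ q.1 ≤ t ∧ q.2 ≤ j} :=
    ⟨hs, hE.nonneg _ hs, hr.1.trans hr.2, le_rfl⟩
  have h2 : (t, j) ∈ E ∩ {q | 0 ≤ q.1 ∧ q.1 ≤ t ∧ q.2 ≤ j} := ⟨ht, hE.nonneg _ ht, le_rfl, le_rfl⟩
  rw [h] at h1 h2
  have h3 : (r, j) ∈ E ∩ {q | 0 ≤ q.1 ∧ q.1 ≤ t ∧ q.2 ≤ j} := by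
    rw [h]; exact ⟨h1.1, h1.2.1.trans hr.1, hr.2.trans h2.2.2⟩
  exact h3.1

theorem zero_mem (hE : IsHybridTimeDomain E) {t : ℝ} (ht : (t, 0) ∈ E) : ((0 : ℝ), 0) ∈ E := by
  obtain ⟨J, T, hT0, hT, h⟩ := hE.compact _ ht
  have h2 : (t, 0) ∈ E ∩ {q | 0 ≤ q.1 ∧ q.1 ≤ t ∧ q.2 ≤ 0} := ⟨ht, hE.nonneg _ ht, le_rfl, le_rfl⟩
  rw [h] at h2
  have h3 : ((0 : ℝ), 0) ∈ E ∩ {q | 0 ≤ q.1 ∧ q.1 ≤ t ∧ q.2 ≤ 0} := by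
    rw [h]; exact ⟨h2.1, hT0.le, hT0 ▸ hT 0 h2.1⟩
  exact h3.1

theorem exists_jump (hE : IsHybridTimeDomain E) {t : ℝ} {j : ℕ} (ht : (t, j + 1) ∈ E) :
    ∃ s ≤ t, (s, j) ∈ E ∧ (s, j + 1) ∈ E := by
  obtain ⟨J, T, -, hT, h⟩ := hE.compact _ ht
  have h2 : (t, j + 1) ∈ E ∩ {q | 0 ≤ q.1 ∧ q.1 ≤ t ∧ q.2 ≤ j + 1} :=
    ⟨ht, hE.nonneg _ ht, le_rfl, le_rfl⟩
  rw [h] at h2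
  obtain ⟨hJ, hle, hle'⟩ := h2
  have hJ' : j < J := (Nat.lt_succ_self j).trans hJ
  have h3 : (T (j + 1), j) ∈ E ∩ {q | 0 ≤ q.1 ∧ q.1 ≤ t ∧ q.2 ≤ j + 1} := by
    rw [h]; exact ⟨hJ', hT j hJ', le_rfl⟩
  have h4 : (T (j + 1), j + 1) ∈ E ∩ {q | 0 ≤ q.1 ∧ q.1 ≤ t ∧ q.2 ≤ j + 1} := by
    rw [h]; exact ⟨hJ, le_rfl, hT (j + 1) hJ⟩
  exact ⟨T (j + 1), hle, h3.1, h4.1⟩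

theorem le_of_jump (hE : IsHybridTimeDomain E) {s t : ℝ} {j : ℕ} (h1 : (s, j) ∈ E)
    (h2 : (s, j + 1) ∈ E) (h3 : (t, j + 1) ∈ E) : s ≤ t := by
  by_contra hcon
  push Not at hcon
  obtain ⟨J, T, -, hT, h⟩ := hE.compact _ h2
  have k1 : (s, j) ∈ E ∩ {q | 0 ≤ q.1 ∧ q.1 ≤ s ∧ q.2 ≤ j + 1} :=
    ⟨h1, hE.nonneg _ h1, le_rfl, Nat.le_succ j⟩
  have k3 : (t, j + 1) ∈ E ∩ {q | 0 ≤ q.1 ∧ q.1 ≤ s ∧ q.2 ≤ j + 1} :=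
    ⟨h3, hE.nonneg _ h3, hcon.le, le_rfl⟩
  rw [h] at k1 k3
  exact absurd (k1.2.2.trans k3.2.1) (not_le.2 hcon)

end IsHybridTimeDomain

/-! ### Components of the hybrid state during flow -/

section Flow

variable {p q nu nw : ℕ} {P : Loop p q nu nw} {Γ : XVec p q → ℝ → ℝ} {S : ℝ → XVec p q → ℝ}
  {w : ℝ → Vec nw} {E : Set (ℝ × ℕ)} {ξ : ℝ → ℕ → HState p q} {j : ℕ} {a b : ℝ}

theorem HybridSystem.IsSolution.ae_hasDerivAt {Ξ U : Type*} [NormedAddCommGroup Ξ]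
    [NormedSpace ℝ Ξ] [NormedAddCommGroup U] {H : HybridSystem Ξ U} {w : ℝ → U}
    {ξ : ℝ → ℕ → Ξ} (h : H.IsSolution w E ξ) (ha : (a, j) ∈ E) (hb : (b, j) ∈ E) :
    ∀ᵐ t, t ∈ Ioo a b → ξ t j ∈ H.C ∧ HasDerivAt (fun s => ξ s j) (H.F (ξ t j) (w t)) t := by
  filter_upwards [h.flow j] with t ht htI
  have hsub : Icc a b ⊆ {s | (s, j) ∈ E} := fun s hs => h.domain.mem_of_mem_Icc ha hb hs
  obtain ⟨h1, h2⟩ := ht (hsub (Ioo_subset_Icc_self htI))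
  exact ⟨h1, h2.hasDerivAt (mem_of_superset (Icc_mem_nhds htI.1 htI.2) hsub)⟩

/-- A linear functional whose flow velocity is constant is affine in time. -/
theorem HybridSystem.IsSolution.linear_eq {Ξ U F : Type*} [NormedAddCommGroup Ξ]
    [NormedSpace ℝ Ξ] [NormedAddCommGroup U] [NormedAddCommGroup F] [NormedSpace ℝ F]
    {H : HybridSystem Ξ U} {w : ℝ → U}
    {ξ : ℝ → ℕ → Ξ} (h : H.IsSolution w E ξ) (ha : (a, j) ∈ E) (hb : (b, j) ∈ E)
    (ℓ : Ξ →L[ℝ] F) (v : F) (hv : ∀ z u, ℓ (H.F z u) = v) {t : ℝ} (ht : t ∈ Icc a b) :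
    ℓ (ξ t j) = ℓ (ξ a j) + (t - a) • v := by
  have hab : a ≤ b := ht.1.trans ht.2
  have hac := lipschitzOnWith_comp_absolutelyContinuous (s := univ) ℓ.lipschitz.lipschitzOnWith
    (h.absCont j a b hab ha hb) (mapsTo_univ _ _)
  have hac2 : AbsolutelyContinuousOnInterval (fun t : ℝ => (t - a) • v) a b :=
    ContDiffOn.absolutelyContinuousOnInterval (ContDiff.contDiffOn (by fun_prop))
  obtain ⟨C, hC⟩ := (hac.fun_sub hac2).const_of_ae_hasDerivAt_zero (by
    filter_upwards [h.ae_hasDerivAt ha hb, Measure.ae_ne volume a, Measure.ae_ne volume b]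
      with s h1 h2 h3 hs
    rw [uIcc_of_le hab] at hs
    have h4 := (h1 ⟨lt_of_le_of_ne hs.1 h2.symm, lt_of_le_of_ne hs.2 h3⟩).2
    have h5 := ℓ.hasFDerivAt.comp_hasDerivAt s h4
    rw [hv] at h5
    have h6 := h5.sub (((hasDerivAt_id s).sub_const a).smul_const v)
    rw [one_smul, sub_self] at h6
    exact h6)
  rw [uIcc_of_le hab] at hC
  have h1 := hC t ht
  have h2 := hC a (left_mem_Icc.2 hab)
  rw [← h2] at h1
  simp only [sub_self, zero_smul, sub_zero] at h1
  rw [← h1]; abel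

theorem stc_η_eq (h : (stcSystem P Γ S).IsSolution w E ξ) (ha : (a, j) ∈ E)
    (hb : (b, j) ∈ E) {t : ℝ} (ht : t ∈ Icc a b) : (ξ t j).η = (ξ a j).η := by
  have := h.linear_eq ha hb ((ContinuousLinearMap.fst ℝ ℝ (ℝ × ℝ)).comp
    ((ContinuousLinearMap.snd ℝ (XVec p q) (ℝ × ℝ × ℝ)).comp
      (ContinuousLinearMap.snd ℝ (XVec p q) (XVec p q × ℝ × ℝ × ℝ)))) 0 (fun _ _ => rfl) ht
  simpa using this

theorem stc_τ_eq (h : (stcSystem P Γ S).IsSolution w E ξ) (ha : (a, j) ∈ E)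
    (hb : (b, j) ∈ E) {t : ℝ} (ht : t ∈ Icc a b) : (ξ t j).τ = (ξ a j).τ + (t - a) := by
  have := h.linear_eq ha hb ((ContinuousLinearMap.fst ℝ ℝ ℝ).comp
    ((ContinuousLinearMap.snd ℝ ℝ (ℝ × ℝ)).comp
    ((ContinuousLinearMap.snd ℝ (XVec p q) (ℝ × ℝ × ℝ)).comp
      (ContinuousLinearMap.snd ℝ (XVec p q) (XVec p q × ℝ × ℝ × ℝ))))) 1 (fun _ _ => rfl) ht
  simpa using this

theorem stc_τmax_eq (h : (stcSystem P Γ S).IsSolution w E ξ) (ha : (a, j) ∈ E)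
    (hb : (b, j) ∈ E) {t : ℝ} (ht : t ∈ Icc a b) : (ξ t j).τmax = (ξ a j).τmax := by
  have := h.linear_eq ha hb ((ContinuousLinearMap.snd ℝ ℝ ℝ).comp
    ((ContinuousLinearMap.snd ℝ ℝ (ℝ × ℝ)).comp
    ((ContinuousLinearMap.snd ℝ (XVec p q) (ℝ × ℝ × ℝ)).comp
      (ContinuousLinearMap.snd ℝ (XVec p q) (XVec p q × ℝ × ℝ × ℝ))))) 0 (fun _ _ => rfl) ht
  simpa using this

/-- Since `g = -f`, the sampled state is conserved; with `e = 0` after a jump it gives the error `x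
a - x t` of `IsFlowArc`. -/
theorem stc_x_add_e_eq (h : (stcSystem P Γ S).IsSolution w E ξ) (ha : (a, j) ∈ E)
    (hb : (b, j) ∈ E) {t : ℝ} (ht : t ∈ Icc a b) :
    (ξ t j).x + (ξ t j).e = (ξ a j).x + (ξ a j).e := by
  have := h.linear_eq ha hb (ContinuousLinearMap.fst ℝ (XVec p q) (XVec p q × ℝ × ℝ × ℝ) +
    (ContinuousLinearMap.fst ℝ (XVec p q) (ℝ × ℝ × ℝ)).comp
      (ContinuousLinearMap.snd ℝ (XVec p q) (XVec p q × ℝ × ℝ × ℝ))) 0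
    (fun z u => by simp [stcSystem, Loop.g]) ht
  simpa using this

/-- The flow set is known to be respected only at almost every time, so the inequality is read off
at times arbitrarily close to `b`. -/
theorem stc_flow_length (h : (stcSystem P Γ S).IsSolution w E ξ) (ha : (a, j) ∈ E)
    (hb : (b, j) ∈ E) (hab : a < b) : (ξ a j).τ + (b - a) ≤ (ξ a j).τmax := by
  refine le_of_forall_pos_sub_le fun ε hε => ?_
  have hlt : max a (b - ε) < b := max_lt hab (by linarith)
  have hvol : volume (Ioo (max a (b - ε)) b) ≠ 0 := by
    rw [Real.volume_Ioo]; simpa using ⟨hab, hε⟩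
  obtain ⟨t, ht, htC⟩ : ∃ t ∈ Ioo (max a (b - ε)) b, (ξ t j).τ ≤ (ξ t j).τmax := by
    by_contra hcon
    push Not at hcon
    refine hvol (measure_mono_null ?_ (ae_iff.1 (h.ae_hasDerivAt ha hb)))
    intro t ht hcon'
    exact absurd (hcon' ⟨(le_max_left _ _).trans_lt ht.1, ht.2⟩).1 (not_le.2 (hcon t ht))
  have htI : t ∈ Icc a b := ⟨((le_max_left _ _).trans_lt ht.1).le, ht.2.le⟩
  rw [stc_τ_eq h ha hb htI, stc_τmax_eq h ha hb htI] at htC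
  have := (le_max_right _ _).trans_lt ht.1
  linarith

theorem stc_isFlowArc (h : (stcSystem P Γ S).IsSolution w E ξ) (ha : (a, j) ∈ E)
    (hb : (b, j) ∈ E) {wbar : ℝ} (hw : BoundedDisturbance wbar w) (hab : a ≤ b)
    (he : (ξ a j).e = 0) : IsFlowArc P wbar w (fun t => (ξ t j).x) a b where
  bound t ht := hw t ((h.domain.nonneg _ ha).trans ht.1)
  meas := by
    have h0 : Icc a b ⊆ Ici 0 := fun t ht => (h.domain.nonneg _ ha).trans ht.1
    exact (h.input.integrableOn_compact_subset h0 isCompact_Icc).aestronglyMeasurable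
  absCont := lipschitzOnWith_comp_absolutelyContinuous (s := univ) (LipschitzWith.prod_fst.lipschitzOnWith)
    (h.absCont j a b hab ha hb) (mapsTo_univ _ _)
  deriv := by
    filter_upwards [h.ae_hasDerivAt ha hb] with t ht htI
    have h1 := (ht htI).2
    have h2 := stc_x_add_e_eq h ha hb (Ioo_subset_Icc_self htI)
    rw [he, add_zero] at h2
    rw [← h2, add_sub_cancel_left]
    have h3 := (ContinuousLinearMap.fst ℝ (XVec p q)
      (XVec p q × ℝ × ℝ × ℝ)).hasFDerivAt.comp_hasDerivAt t h1
    exact h3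

end Flow

/-! ### Stability -/

theorem isClassKL_exp {c k : ℝ} (hc : 0 < c) (hk : 0 < k) :
    IsClassKL fun s t => s * (c * Real.exp (-k * t)) where
  continuousOn := Continuous.continuousOn (by fun_prop)
  classK t _ :=
    { continuousOn := Continuous.continuousOn (by fun_prop)
      strictMonoOn := fun s _ s' _ hss => by
        have : 0 < c * Real.exp (-k * t) := by positivity
        exact mul_lt_mul_of_pos_right hss this
      map_zero := by simp }
  antitoneOn s hs t _ t' _ htt := by
    have : Real.exp (-k * t') ≤ Real.exp (-k * t) := Real.exp_le_exp.2 (by nlinarith)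
    change s * (c * Real.exp (-k * t')) ≤ s * (c * Real.exp (-k * t))
    gcongr
  tendsto_zero s _ := by
    have h1 : Tendsto (fun t : ℝ => -k * t) atTop atBot :=
      tendsto_id.const_mul_atTop_of_neg (neg_neg_of_pos hk)
    have := ((Real.tendsto_exp_atBot.comp h1).const_mul c).const_mul s
    simpa using this

theorem isClassKLL_exp {c k l : ℝ} (hc : 0 < c) (hk : 0 < k) (hl : 0 < l) :
    IsClassKLL fun s t r => s * (c * Real.exp (-k * t) * Real.exp (-l * r)) where
  left r _ := by
    convert! isClassKL_exp (c := c * Real.exp (-k * r)) (by positivity) hl using 1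
  right r _ := by
    convert! isClassKL_exp (c := c * Real.exp (-l * r)) (by positivity) hk using 1
    funext s t
    ring

/-! ### Sampling instants and decay along hybrid solutions -/

section Stability

variable {p q nu nw npar nc : ℕ} [NeZero npar] [NeZero nc] {P : Loop p q nu nw}
  {V : XVec p q → ℝ} {aw cw : ℝ} {A : Params npar nc} {w : ℝ → Vec nw} {E : Set (ℝ × ℕ)}
  {ξ : ℝ → ℕ → HState p q}

theorem stc_flow_le_refΓ (htMin : 0 < A.tMin)
    (h : (stcSystem P (A.refΓ V aw cw) (A.refS V aw cw)).IsSolution w E ξ) {s t : ℝ} {j : ℕ}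
    (hs : (s, j) ∈ E) (hs' : (s, j + 1) ∈ E) (ht : (t, j + 1) ∈ E) :
    t - s ≤ A.refΓ V aw cw (ξ s j).x (ξ s j).η := by
  have hjump := (h.jump s j hs hs').2
  rcases (h.domain.le_of_jump hs hs' ht).eq_or_lt with rfl | hst
  · rw [sub_self]
    exact htMin.le.trans (Params.tMin_le_algorithm _ _ _)
  · have h1 := stc_flow_length h hs' ht hst
    rw [hjump] at h1
    change 0 + (t - s) ≤ _ at h1
    rwa [zero_add] at h1

theorem stc_sampling_interval_eq
    (h : (stcSystem P (A.refΓ V aw cw) (A.refS V aw cw)).IsSolution w E ξ) {s t : ℝ} {j : ℕ}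
    (hs : (s, j) ∈ E) (hs' : (s, j + 1) ∈ E) (ht : (t, j + 1) ∈ E) (ht' : (t, j + 2) ∈ E) :
    t - s = A.refΓ V aw cw (ξ s j).x (ξ s j).η := by
  have hjump := (h.jump s j hs hs').2
  have hst := h.domain.le_of_jump hs hs' ht
  have h1 : (ξ t (j + 1)).τ = (ξ t (j + 1)).τmax := (h.jump t (j + 1) ht ht').1
  rw [stc_τ_eq h hs' ht (right_mem_Icc.2 hst), stc_τmax_eq h hs' ht (right_mem_Icc.2 hst),
    hjump] at h1
  change 0 + (t - s) = _ at h1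
  rwa [zero_add] at h1

/-- A jump scales `η` by the length of the interval that is about to begin. When that interval ends
with a jump, `η` equals the reference function there. -/
theorem stc_η_next (h : (stcSystem P (A.refΓ V aw cw) (A.refS V aw cw)).IsSolution w E ξ)
    {s t : ℝ} {j : ℕ} (hs : (s, j) ∈ E) (hs' : (s, j + 1) ∈ E) (ht : (t, j + 1) ∈ E)
    (ht' : (t, j + 2) ∈ E) :
    (ξ t (j + 1)).η = Real.exp (-A.εref * (t - s)) * (ξ s j).η := by
  rw [stc_sampling_interval_eq h hs hs' ht ht', stc_η_eq h hs' ht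
    (right_mem_Icc.2 (h.domain.le_of_jump hs hs' ht)), (h.jump s j hs hs').2]
  rfl

/-- Before the first jump no time passes. -/
theorem stc_eq_zero_of_mem (h : (stcSystem P (A.refΓ V aw cw) (A.refS V aw cw)).IsSolution w E ξ)
    {cmax : ℝ} (hinit : ξ 0 0 ∈ refInit V cw cmax) {t : ℝ} (ht : (t, 0) ∈ E) : t = 0 := by
  by_contra hne
  have hpos : 0 < t := lt_of_le_of_ne (h.domain.nonneg _ ht) (Ne.symm hne)
  have h1 := stc_flow_length h (h.domain.zero_mem ht) ht hpos
  rw [hinit.2.1] at h1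
  linarith

variable {wbar cmax s₀ κ : ℝ}

/-- The decay estimate, carried along the sampling instants. -/
theorem stc_decay (htMin : 0 < A.tMin) (hκ : κ ≤ A.εref) (hκ0 : 0 < κ)
    (hcwmax : cw ≤ cmax) (hcmax : ∃ l, cmax ≤ A.c l)
    (hdecay : ∀ {a b η : ℝ} {x : ℝ → XVec p q}, a ≤ b → 0 ≤ η → IsFlowArc P wbar w x a b →
      (∃ l, max (V (x a)) (cw + η) ≤ A.c l) →
      b - a ≤ A.algorithm aw (V (x a)) (cw + η) →
      ∀ t ∈ Icc a b, V (x t) - cw ≤ Real.exp (-κ * (t - a)) * max (max (V (x a) - cw) 0) η)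
    (hw : BoundedDisturbance wbar w)
    (h : (stcSystem P (A.refΓ V aw cw) (A.refS V aw cw)).IsSolution w E ξ)
    (hinit : ξ 0 0 ∈ refInit V cw cmax) (hVmax : V (ξ 0 0).x ≤ cmax)
    (hs₀ : s₀ = max (V (ξ 0 0).x - cw) 0) :
    ∀ (j : ℕ) (t : ℝ), (t, j) ∈ E →
      V (ξ t j).x - cw ≤ s₀ * Real.exp (-κ * t) ∧ ((j : ℝ) - 1) * A.tMin ≤ t ∧
      ((t, j + 1) ∈ E → j * A.tMin ≤ t ∧ (ξ t j).η = s₀ * Real.exp (-A.εref * t)) := by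
  have hs0 : 0 ≤ s₀ := hs₀ ▸ le_max_right _ _
  have hη0 : (ξ 0 0).η = s₀ := by
    rw [hinit.2.2, refη, ← hs₀, min_eq_left]
    rw [hs₀]
    exact max_le (by linarith) (by linarith)
  have hs0max : cw + s₀ ≤ cmax := by
    rw [hs₀, ← max_add_add_left]
    exact max_le (by linarith) (by linarith)
  intro j
  -- The value of `η` is tracked only just before a jump: after it, `η` already holds the value for
  -- the next instant. The count `j - 1` appears because the first jump takes place at time zero.
  induction j with
  | zero =>
    intro t ht
    obtain rfl := stc_eq_zero_of_mem h hinit ht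
    refine ⟨?_, by simpa using htMin.le, fun _ => ⟨by simp, by simpa using hη0⟩⟩
    simp only [mul_zero, Real.exp_zero, mul_one]
    rw [hs₀]; exact le_max_left _ _
  | succ j ih =>
    intro t ht
    obtain ⟨s, hst, hs, hs'⟩ := h.domain.exists_jump ht
    obtain ⟨ihV, -, ih'⟩ := ih s hs
    obtain ⟨ihj, ihη⟩ := ih' hs'
    have hs_nonneg : 0 ≤ s := h.domain.nonneg _ hs
    have hjump := (h.jump s j hs hs').2
    have hx : (ξ s (j + 1)).x = (ξ s j).x := by rw [hjump]; rfl
    have he : (ξ s (j + 1)).e = 0 := by rw [hjump]; rfl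
    have hexp1 : ∀ k, 0 ≤ k → Real.exp (-k * s) ≤ 1 := fun k hk =>
      Real.exp_le_one_iff.2 (by nlinarith)
    have hVs : V (ξ s j).x ≤ cmax := by
      have := mul_le_of_le_one_right hs0 (hexp1 κ hκ0.le)
      linarith
    have hηs : 0 ≤ (ξ s j).η := by rw [ihη]; positivity
    have hηs' : (ξ s j).η ≤ s₀ * Real.exp (-κ * s) := by
      rw [ihη]
      gcongr
    have harc := stc_isFlowArc h hs' ht hw hst he
    have hV := hdecay hst hηs harc (by
      obtain ⟨l, hl⟩ := hcmax
      refine ⟨l, max_le ?_ ?_⟩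
      · rw [hx]; exact hVs.trans hl
      · have := mul_le_of_le_one_right hs0 (hexp1 κ hκ0.le)
        linarith) (by
      rw [hx]; exact stc_flow_le_refΓ htMin h hs hs' ht) t (right_mem_Icc.2 hst)
    rw [hx] at hV
    refine ⟨hV.trans ?_, by push_cast; linarith, fun ht' => ?_⟩
    · have h1 : max (max (V (ξ s j).x - cw) 0) (ξ s j).η ≤ s₀ * Real.exp (-κ * s) :=
        max_le (max_le ihV (by positivity)) hηs'
      calc Real.exp (-κ * (t - s)) * max (max (V (ξ s j).x - cw) 0) (ξ s j).η
          ≤ Real.exp (-κ * (t - s)) * (s₀ * Real.exp (-κ * s)) := by gcongr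
        _ = s₀ * (Real.exp (-κ * (t - s)) * Real.exp (-κ * s)) := by ring
        _ = s₀ * Real.exp (-κ * t) := by rw [← Real.exp_add]; ring_nf
    · constructor
      · have h1 := stc_sampling_interval_eq h hs hs' ht ht'
        have h2 : A.tMin ≤ t - s := h1 ▸ Params.tMin_le_algorithm _ _ _
        push_cast
        linarith
      · rw [stc_η_next h hs hs' ht ht', ihη]
        calc Real.exp (-A.εref * (t - s)) * (s₀ * Real.exp (-A.εref * s))
            = s₀ * (Real.exp (-A.εref * (t - s)) * Real.exp (-A.εref * s)) := by ring
          _ = _ := by rw [← Real.exp_add]; ring_nf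

end Stability

end DynSTC

end

/-! ### Main theorem: uniform decay rate and class `𝒦ℒℒ` bound -/

theorem theorem6 {p q nu nw npar nc : ℕ} [NeZero npar] [NeZero nc]
    (P : DynSTC.Loop p q nu nw)
    (hf : Continuous fun z : DynSTC.XVec p q × DynSTC.XVec p q × DynSTC.Vec nw =>
      P.f z.1 z.2.1 z.2.2)
    (wbar : ℝ) (hwbar : 0 < wbar)
    (V : DynSTC.XVec p q → ℝ) (αw : ℝ → ℝ)
    (A : DynSTC.Params npar nc)
    (hεref : 0 < A.εref) (hδ : A.δ ∈ Set.Ioo (0 : ℝ) 1)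
    (hA : ∀ (i : Fin npar) (l : Fin nc),
      DynSTC.LocalHybridLyapunov P wbar V αw (A.c l) (A.ε i l) (A.γ i l) (A.L i l))
    (hε1 : ∀ l, 0 < A.ε 0 l) (hεi : ∀ i, i ≠ 0 → ∀ l, A.ε i l < 0)
    (cw cmax : ℝ) (hcwmax : cw ≤ cmax) (hcmax : ∃ l, cmax ≤ A.c l)
    (hcw : ∀ l, αw wbar / A.ε 0 l ≤ cw)
    -- no level `c_l` is a local minimum value of `V`
    (hlevel : ∀ l x, V x = A.c l → ¬ IsLocalMin V x)
    -- in the limit case `c_w = max_l α_w(w̄) / ε_{1,l}`, continuity of `f` does not suffice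
    (hreg : (∀ l, αw wbar / A.ε 0 l < cw) ∨ P.IsLipschitzOnBounded wbar) :
    0 < A.tMin ∧
    (∀ w : ℝ → DynSTC.Vec nw, DynSTC.BoundedDisturbance wbar w →
      ∀ (E : Set (ℝ × ℕ)) (ξ : ℝ → ℕ → DynSTC.HState p q),
        (DynSTC.stcSystem P (A.refΓ V (αw wbar) cw) (A.refS V (αw wbar) cw)).IsSolution w E ξ →
        ξ 0 0 ∈ DynSTC.refInit V cw cmax →
        -- `t` and `t'` are consecutive sampling instants
        ∀ (j : ℕ) (t t' : ℝ), (t, j) ∈ E → (t, j + 1) ∈ E → (t', j + 1) ∈ E → (t', j + 2) ∈ E →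
          A.tMin ≤ t' - t) ∧
    DynSTC.IsRAS (DynSTC.stcSystem P (A.refΓ V (αw wbar) cw) (A.refS V (αw wbar) cw))
      wbar V cw cmax (DynSTC.refInit V cw cmax) := by
  have hfb : ∀ l, 0 < A.fallback l := fun l =>
    mul_pos hδ.1 (DynSTC.Tmax_pos_and_exists_riccati (hA 0 l).γ_pos
      (by have := (hA 0 l).L_pos; have := hε1 l; positivity)).1
  have htMin := DynSTC.Params.tMin_pos hfb
  refine ⟨htMin, ?_, ?_⟩
  · intro w _ E ξ h _ j t t' h1 h2 h3 h4
    rw [DynSTC.stc_sampling_interval_eq h h1 h2 h3 h4]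
    exact DynSTC.Params.tMin_le_algorithm _ _ _
  obtain ⟨l₀, hl₀⟩ := Finite.exists_min (A.ε 0)
  set κ := min A.εref (A.ε 0 l₀)
  have hκ0 : 0 < κ := lt_min hεref (hε1 l₀)
  have hκ1 : ∀ l, κ ≤ A.ε 0 l := fun l => (min_le_right _ _).trans (hl₀ l)
  -- Half of the rate `κ` is kept for `t`; the other half is spent through `(j - 1) * tMin ≤ t`, and
  -- the `-1` accounts for the factor `exp (κ / 2 * tMin)`.
  refine ⟨_, DynSTC.isClassKLL_exp (c := Real.exp (κ / 2 * A.tMin)) (k := κ / 2)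
    (l := κ / 2 * A.tMin) (Real.exp_pos _) (by positivity) (by positivity), ?_⟩
  intro w hw E ξ h hinit hVmax t j htj
  obtain ⟨hV, hj, -⟩ := DynSTC.stc_decay htMin (min_le_left _ _) hκ0 hcwmax hcmax
    (fun hab hη hx hl hb => hx.decay hf hwbar hεref hδ hA hε1 hεi hcw hlevel hreg hκ1
      (min_le_left _ _) hab hη hl hb) hw h hinit hVmax rfl j t htj
  set s₀ := max (V (ξ 0 0).x - cw) 0
  have hs₀ : 0 ≤ s₀ := le_max_right _ _
  have h1 : Real.exp (-κ * t) ≤ Real.exp (κ / 2 * A.tMin) * Real.exp (-(κ / 2) * t) *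
      Real.exp (-(κ / 2 * A.tMin) * j) := by
    rw [← Real.exp_add, ← Real.exp_add]
    exact Real.exp_le_exp.2 (by nlinarith)
  have h2 : s₀ * Real.exp (-κ * t) ≤ (s₀ + √(‖(ξ 0 0).e‖ ^ 2 + (ξ 0 0).η ^ 2)) *
      (Real.exp (κ / 2 * A.tMin) * Real.exp (-(κ / 2) * t) *
      Real.exp (-(κ / 2 * A.tMin) * j)) := by
    have := Real.sqrt_nonneg (‖(ξ 0 0).e‖ ^ 2 + (ξ 0 0).η ^ 2)
    gcongr
    linarith
  linarith
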